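/- Let $d\ge 2$ and $T>0$, and let $b,f:(0,T)\times\mathbf R^d\to\mathbf R^d$ be measurable. Functions on $(0,T)\times\mathbf R^d$ or $[0,T]\times\mathbf R^d$ are extended by zero to all other times. For $p>d$, a measurable function $g$ of $(t,x)$ is said to satisfy Hypothesis $\mathrm H_p$ if there is a constant $M>0$ such that $$\sup_{t\ge 0,\;x\in\mathbf R^d}\int_0^{r^2}\int_{B(x,r)}|g(t+s,y)|\,dy\,ds\le M r^p\qquad\text{for all } 0<r<1 .$$ Let $q_t(x,y)=(2\pi t)^{-d/2}e^{-|x-y|^2/(2t)}$, and let $C_b^{0,1}([0,T]\times\mathbf R^d)$ be the space of functions $u:[0,T]\times\mathbf R^d\to\mathbf R^d$ such that $u$ and its spatial gradient $\nabla_x u$ exist, are continuous and are bounded on $[0,T]\times\mathbf R^d$. A function $u\in C_b^{0,1}([0,T]\times\mathbf R^d)$ is a mild solution of $$\partial_t u+\tfrac12\Delta u+\langle b,\nabla_x u\rangle=f\ \text{ on }(0,T)\times\mathbf R^d,\qquad u(T,\cdot)=0,$$ if for all $(t,x)\in[0,T]\times\mathbf R^d$ $$u(t,x)=\int_t^T\int_{\mathbf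 R^d}q_{s-t}(x,y)\,\bigl[\langle b(s,y),\nabla_y u(s,y)\rangle-f(s,y)\bigr]\,dy\,ds ,$$ the integral being absolutely convergent. **Proposition.** Let $p>d$, assume that $|b|^2$ and $|f|^2$ satisfy Hypothesis $\mathrm H_p$, and let $u\in C_b^{0,1}([0,T]\times\mathbf R^d)$ be a mild solution of the above equation. Then $u$ has a locally integrable weak spatial Hessian $D^2_xu=(\partial_{x_i}\partial_{x_j}u^k)_{i,j,k}$ on $(0,T)\times\mathbf R^d$, and $\|D^2_xu\|^2$ satisfies Hypothesis $\mathrm H_q$ for some $q\in(d,p)$, where $\|D^2_xu\|=\max_{i,j,k}|\partial_{x_i}\partial_{x_j}u^k|$. -/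

import Mathlib

open MeasureTheory Set
open scoped ContDiff ENNReal

/-- The Euclidean space `ℝ^d`. -/
abbrev Rd (d : ℕ) : Type := EuclideanSpace ℝ (Fin d)

/-- The transition density of the standard `d`-dimensional Brownian motion,
`q(t, x, y) = (2 π t)^(-d/2) exp (-|x - y|^2 / (2 t))`, used for `t > 0`. -/
noncomputable def heatKernel (d : ℕ) (t : ℝ) (x y : Rd d) : ℝ :=
  (2 * Real.pi * t) ^ (-(d : ℝ) / 2) * Real.exp (-‖x - y‖ ^ 2 / (2 * t))

/-- The convention that a function on `[0, T] × ℝ^d` vanishes outside `[0, T] × ℝ^d`. -/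
noncomputable def extendByZero {d : ℕ} (T : ℝ) (g : ℝ → Rd d → ℝ) : ℝ → Rd d → ℝ :=
  open Classical in fun t x => if t ∈ Icc 0 T then g t x else 0

/-- Hypothesis `H_p` for a function `g` of time and space: `p > d`, and for some `M > 0`,
`sup_{t ≥ 0, x} ∫_0^{r^2} ∫_{B(x,r)} |g(t+s,y)| dy ds ≤ M r^p` for all `0 < r < 1`.
The integrals are taken in `[0, ∞]`, so the bound includes their finiteness. -/
def HypothesisH (d : ℕ) (p : ℝ) (g : ℝ → Rd d → ℝ) : Prop :=
  (d : ℝ) < p ∧ ∃ M : ℝ, 0 < M ∧ ∀ r : ℝ, 0 < r → r < 1 →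
    ⨆ t : Ici (0 : ℝ), ⨆ x : Rd d,
      ∫⁻ s in Ioo 0 (r ^ 2), ∫⁻ y in Metric.ball x r, ‖g (t + s) y‖ₑ
        ≤ ENNReal.ofReal (M * r ^ p)

/-- The class `C_b^{0,1}([0,T] × ℝ^d)` of `ℝ^d`-valued functions: `u` and its spatial derivative
`∇_x u` exist, are jointly continuous and bounded on `[0,T] × ℝ^d`. -/
structure IsCb01 {d : ℕ} (T : ℝ) (u : ℝ → Rd d → Rd d) : Prop where
  continuousOn : ContinuousOn (fun z : ℝ × Rd d => u z.1 z.2) (Icc 0 T ×ˢ univ)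
  bounded : ∃ C : ℝ, ∀ t ∈ Icc 0 T, ∀ x, ‖u t x‖ ≤ C
  differentiable : ∀ t ∈ Icc 0 T, Differentiable ℝ (u t)
  continuousOn_fderiv :
    ContinuousOn (fun z : ℝ × Rd d => fderiv ℝ (u z.1) z.2) (Icc 0 T ×ˢ univ)
  bounded_fderiv : ∃ C : ℝ, ∀ t ∈ Icc 0 T, ∀ x, ‖fderiv ℝ (u t) x‖ ≤ C

/-- `u` is a mild solution in `C_b^{0,1}([0,T] × ℝ^d)` of the backward equation
`∂_t u + (1/2) Δ u + ⟨b, ∇_x u⟩ = f` on `(0,T) × ℝ^d`, `u(T, ·) = 0`, that is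
`u(t,x) = ∫_t^T ∫_{ℝ^d} q(s-t,x,y) [⟨b(s,y), ∇_y u(s,y)⟩ - f(s,y)] dy ds`
on `[0,T] × ℝ^d`, with an absolutely convergent integral. The `k`-th component of
`fderiv ℝ (u s) y (b s y)` is `⟨b(s,y), ∇_y u^k(s,y)⟩`. -/
structure IsMildSolution {d : ℕ} (T : ℝ) (b f u : ℝ → Rd d → Rd d) : Prop where
  isCb01 : IsCb01 T u
  integrableOn : ∀ t ∈ Icc 0 T, ∀ x, IntegrableOn
    (fun z : ℝ × Rd d =>
      heatKernel d (z.1 - t) x z.2 • (fderiv ℝ (u z.1) z.2 (b z.1 z.2) - f z.1 z.2))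
    (Ioo t T ×ˢ univ)
  eq_integral : ∀ t ∈ Icc 0 T, ∀ x,
    u t x = ∫ s in Ioo t T, ∫ y,
      heatKernel d (s - t) x y • (fderiv ℝ (u s) y (b s y) - f s y)

/-- The spatial partial derivative `∂_{x_i} φ` of a function on `ℝ × ℝ^d`. -/
noncomputable def spatialPartial {d : ℕ} (i : Fin d) (φ : ℝ × Rd d → ℝ) : ℝ × Rd d → ℝ :=
  fun z => lineDeriv ℝ φ z (0, EuclideanSpace.single i 1)

/-- `w` is the weak spatial Hessian `D^2_x u` of `u` on `(0,T) × ℝ^d`: `w t x k i j` is a locally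
integrable weak derivative `∂_{x_i} ∂_{x_j} u^k`, tested against `C_c^∞((0,T) × ℝ^d)`. -/
structure IsWeakHessian {d : ℕ} (T : ℝ) (u : ℝ → Rd d → Rd d)
    (w : ℝ → Rd d → Fin d → Fin d → Fin d → ℝ) : Prop where
  measurable : Measurable (fun z : ℝ × Rd d => w z.1 z.2)
  locallyIntegrableOn :
    LocallyIntegrableOn (fun z : ℝ × Rd d => w z.1 z.2) (Ioo 0 T ×ˢ univ)
  integral_eq : ∀ φ : ℝ × Rd d → ℝ, ContDiff ℝ ∞ φ → HasCompactSupport φ →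
    tsupport φ ⊆ Ioo 0 T ×ˢ univ → ∀ k i j : Fin d,
      ∫ z in Ioo 0 T ×ˢ univ, u z.1 z.2 k * spatialPartial i (spatialPartial j φ) z
        = ∫ z in Ioo 0 T ×ˢ univ, w z.1 z.2 k i j * φ z

/-! Each component of `u` is a backward heat potential of the source `h = ⟨b, ∇u⟩ - f`. Since `∇u`
is bounded, `|h|²` inherits the growth of `|b|²` and `|f|²`: its integral over a parabolic cylinder
`Q_r` is `O(r^q)`, where `q` is any exponent in `(d, p]`. The proof fixes `q` strictly between `d`
and `min p (d + 2)`. The claim is then that second spatial derivatives of heat potentials preserve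
this parabolic Morrey condition, with the same `q`.

The claim is proved by duality. For a test function `φ` supported in `Q_r`, Fubini gives `∫ u ∂ᵢ∂ⱼφ
= ∫ h g`, where `g` is the forward heat potential of `∂ᵢ∂ⱼφ`; it vanishes before the cylinder
starts. Inside the doubled cylinder, Cauchy-Schwarz combines the growth of `|h|²` with the bound
`‖g‖₂ ≤ 2‖φ‖₂` (`lintegral_heatPotential_spatialPartial_sq_le`). That bound follows from Plancherel
in `x` and Young in `t`, because the multiplier `4π²|ξ|² e^{-2π²τ|ξ|²}` has `L¹` norm in `τ` at most
`2`, uniformly in `ξ`.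

Outside the doubled cylinder both derivatives fall on the kernel, so `|g| ≤ C ρ^{-(d+2)} ‖φ‖₁` with
`ρ` the parabolic distance. Summing over dyadic shells gives a geometric series with ratio
`2^((q-d-2)/2)`, which converges because `q < d + 2` (`exists_lintegral_far_le`). The shells have
unbounded radii, so the growth condition is first extended from `r < 1` to all `r`
(`exists_growthBound`).

Together, `|∫ u ∂ᵢ∂ⱼφ| ≤ C r^{q/2} ‖φ‖₂` (`exists_lintegral_mul_heatPotential_le`). Riesz
representation gives an `L²` weak derivative on each cylinder whose squared norm is at most `C²
r^q`. By uniqueness these local derivatives glue to one function, which keeps the bound on every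
cylinder. -/

/-! ### Parabolic cylinders and growth bounds -/

/-- The forward parabolic cylinder `(t, t + r²) × B(x, r)`. -/
def parabolicCylinder {d : ℕ} (t : ℝ) (x : Rd d) (r : ℝ) : Set (ℝ × Rd d) :=
  Ioo t (t + r ^ 2) ×ˢ Metric.ball x r

/-- `∫ F ≤ M r^p` over all forward cylinders of radius `r > 0` starting at nonnegative times. -/
def GrowthBound {d : ℕ} (p M : ℝ) (F : ℝ × Rd d → ℝ≥0∞) : Prop :=
  ∀ t : ℝ, 0 ≤ t → ∀ (x : Rd d) (r : ℝ), 0 < r →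
    ∫⁻ z in parabolicCylinder t x r, F z ≤ ENNReal.ofReal (M * r ^ p)

theorem measurableSet_parabolicCylinder {d : ℕ} (t : ℝ) (x : Rd d) (r : ℝ) :
    MeasurableSet (parabolicCylinder t x r) :=
  measurableSet_Ioo.prod Metric.isOpen_ball.measurableSet

theorem isOpen_parabolicCylinder {d : ℕ} (t : ℝ) (x : Rd d) (r : ℝ) :
    IsOpen (parabolicCylinder t x r) :=
  isOpen_Ioo.prod Metric.isOpen_ball

/-- The volume of the unit ball of `ℝ^d`. -/
noncomputable def unitBallVolume (d : ℕ) : ℝ := (volume (Metric.ball (0 : Rd d) 1)).toReal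

theorem unitBallVolume_pos (d : ℕ) : 0 < unitBallVolume d :=
  ENNReal.toReal_pos (Metric.measure_ball_pos _ _ one_pos).ne'
    Metric.isBounded_ball.measure_lt_top.ne

theorem volume_ball_eq {d : ℕ} (x : Rd d) {r : ℝ} (hr : 0 < r) :
    volume (Metric.ball x r) =
      ENNReal.ofReal (unitBallVolume d * r ^ d) := by
  rw [Measure.addHaar_ball_of_pos _ _ hr, ENNReal.ofReal_mul (unitBallVolume_pos d).le,
    unitBallVolume, ENNReal.ofReal_toReal Metric.isBounded_ball.measure_lt_top.ne, mul_comm]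
  simp

theorem volume_parabolicCylinder {d : ℕ} (t : ℝ) (x : Rd d) {r : ℝ} (hr : 0 < r) :
    volume (parabolicCylinder t x r) =
      ENNReal.ofReal (unitBallVolume d * r ^ (d + 2)) := by
  rw [parabolicCylinder, Measure.volume_eq_prod, Measure.prod_prod, volume_ball_eq x hr,
    Real.volume_Ioo, ← ENNReal.ofReal_mul (by nlinarith)]
  congr 1
  ring

theorem lintegral_parabolicCylinder {d : ℕ} {F : ℝ × Rd d → ℝ≥0∞} (hF : Measurable F)
    (t : ℝ) (x : Rd d) (r : ℝ) :
    ∫⁻ z in parabolicCylinder t x r, F z =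
      ∫⁻ s in Ioo 0 (r ^ 2), ∫⁻ y in Metric.ball x r, F (t + s, y) := by
  rw [parabolicCylinder, Measure.volume_eq_prod, setLIntegral_prod _ hF.aemeasurable,
    ← lintegral_indicator measurableSet_Ioo, ← lintegral_indicator measurableSet_Ioo,
    ← lintegral_add_left_eq_self _ t]
  congr 1
  ext s
  simp only [indicator, mem_Ioo, lt_add_iff_pos_right, add_lt_add_iff_left]

/-- Bounding an integral over a ball by averaging over small balls. -/
theorem lintegral_ball_le_of_forall_ball_le {d : ℕ} {G : Rd d → ℝ≥0∞} (hG : Measurable G)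
    {δ : ℝ} {A : ℝ≥0∞} (hA : ∀ z, ∫⁻ y in Metric.ball z δ, G y ≤ A) (x : Rd d) (r : ℝ) :
    volume (Metric.ball (0 : Rd d) δ) * ∫⁻ y in Metric.ball x r, G y ≤
      volume (Metric.ball x (r + δ)) * A := by
  have hm : MeasurableSet {q : Rd d × Rd d | dist q.2 q.1 < δ} :=
    (isOpen_lt (continuous_snd.dist continuous_fst) continuous_const).measurableSet
  have hmeas : Measurable fun q : Rd d × Rd d =>
      {q : Rd d × Rd d | dist q.2 q.1 < δ}.indicator (fun q => G q.1) q :=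
    (hG.comp measurable_fst).indicator hm
  -- Double counting: integrate `G y` over the pairs with `y ∈ B(x,r)` and `|y - z| < δ`.
  -- Integrating `z` first gives the left side; integrating `y` first forces `z ∈ B(x, r + δ)`.
  calc volume (Metric.ball (0 : Rd d) δ) * ∫⁻ y in Metric.ball x r, G y
      = ∫⁻ y in Metric.ball x r, ∫⁻ z,
          {q : Rd d × Rd d | dist q.2 q.1 < δ}.indicator (fun q => G q.1) (y, z) := by
        rw [← lintegral_const_mul _ hG]
        congr 1
        ext y
        have : ∀ z, {q : Rd d × Rd d | dist q.2 q.1 < δ}.indicator (fun q => G q.1) (y, z) =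
            (Metric.ball y δ).indicator (fun _ => G y) z := fun z => by
          simp [indicator, Metric.mem_ball]
        simp_rw [this]
        rw [lintegral_indicator Metric.isOpen_ball.measurableSet, setLIntegral_const, mul_comm,
          Measure.addHaar_ball_center _ y]
    _ = ∫⁻ z, ∫⁻ y in Metric.ball x r,
          {q : Rd d × Rd d | dist q.2 q.1 < δ}.indicator (fun q => G q.1) (y, z) :=
        lintegral_lintegral_swap hmeas.aemeasurable
    _ ≤ ∫⁻ z, (Metric.ball x (r + δ)).indicator (fun _ => A) z := by
        refine lintegral_mono fun z => ?_
        by_cases hz : z ∈ Metric.ball x (r + δ)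
        · rw [indicator_of_mem hz]
          refine le_trans ?_ (hA z)
          rw [← lintegral_indicator Metric.isOpen_ball.measurableSet (G)]
          refine (setLIntegral_le_lintegral _ _).trans (lintegral_mono fun y => ?_)
          simp only [indicator, Metric.mem_ball, mem_ofPred_eq]
          rw [dist_comm]
        · rw [indicator_of_notMem hz, nonpos_iff_eq_zero]
          refine (setLIntegral_congr_fun Metric.isOpen_ball.measurableSet
            (g := fun _ => 0) fun y hy => ?_).trans (by simp)
          refine indicator_of_notMem (fun h => hz ?_) _
          simp only [Metric.mem_ball, mem_ofPred_eq] at h hy ⊢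
          linarith [dist_triangle z y x]
    _ = volume (Metric.ball x (r + δ)) * A := by
        rw [lintegral_indicator Metric.isOpen_ball.measurableSet, setLIntegral_const, mul_comm]

/-- A growth bound at small radii extends to all radii for functions supported in bounded time. -/
theorem exists_growthBound {d : ℕ} {p T M : ℝ} (hM : 0 ≤ M) (hp : (d : ℝ) ≤ p)
    {F : ℝ × Rd d → ℝ≥0∞} (hF : Measurable F) (hsupp : ∀ z, z.1 ∉ Ioo 0 T → F z = 0)
    (hb : ∀ t : ℝ, 0 ≤ t → ∀ (x : Rd d) (r : ℝ), 0 < r → r < 1 →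
      ∫⁻ z in parabolicCylinder t x r, F z ≤ ENNReal.ofReal (M * r ^ p)) :
    ∃ M' : ℝ, 0 < M' ∧ GrowthBound p M' F := by
  -- `K` counts the time slabs `(k/8, k/8 + 1/4)` used to cover `(0,T)`. Each has the duration of a
  -- cylinder of radius `1/2`, and the overlap ensures that no endpoint is missed.
  set K : ℕ := ⌈8 * T⌉₊ with hK
  have hp0 : 0 ≤ p := le_trans (by positivity) hp
  refine ⟨M + K * (3 ^ d * M) + 1, by positivity, fun t ht x r hr => ?_⟩
  rcases lt_or_ge r 1 with h1 | h1
  · refine (hb t ht x r hr h1).trans (ENNReal.ofReal_le_ofReal ?_)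
    gcongr
    have : 0 ≤ (K : ℝ) * (3 ^ d * M) := by positivity
    linarith
  -- On one slab, averaging over balls of radius `1/2` gives a bound of order `r^d`, which is at
  -- most `r^p` as `r ≥ 1`. The factor `3 ^ d` comes from `r + 1/2 ≤ 3r/2`.
  have hball : ∀ k : ℕ, ∫⁻ y in Metric.ball x r, ∫⁻ s in Ioo (k / 8 : ℝ) (k / 8 + 1 / 4), F (s, y)
      ≤ ENNReal.ofReal (3 ^ d * M * r ^ p) := by
    intro k
    have hmeas : Measurable fun y => ∫⁻ s in Ioo (k / 8 : ℝ) (k / 8 + 1 / 4), F (s, y) :=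
      hF.lintegral_prod_left'
    have h0 := lintegral_ball_le_of_forall_ball_le hmeas (δ := 1 / 2)
      (A := ENNReal.ofReal (M * (1 / 2 : ℝ) ^ p)) (fun z => by
        refine le_trans (le_of_eq ?_) (hb (k / 8) (by positivity) z (1 / 2) (by norm_num)
          (by norm_num))
        rw [parabolicCylinder, Measure.volume_eq_prod, setLIntegral_prod_symm _ hF.aemeasurable]
        norm_num) x r
    have hv := unitBallVolume_pos d
    set v := unitBallVolume d
    rw [volume_ball_eq _ (by norm_num), volume_ball_eq _ (by positivity),
      ← ENNReal.ofReal_mul (by positivity)] at h0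
    have hc : 0 < v * (1 / 2) ^ d := by positivity
    rw [← ENNReal.mul_le_mul_iff_right (a := ENNReal.ofReal (v * (1 / 2) ^ d)) (by simpa using hc)
      ENNReal.ofReal_ne_top, ← ENNReal.ofReal_mul hc.le]
    refine h0.trans (ENNReal.ofReal_le_ofReal ?_)
    have e1 : (r + 1 / 2) ^ d ≤ (1 / 2) ^ d * (3 ^ d * r ^ d) := by
      rw [← mul_pow, ← mul_pow]
      gcongr
      linarith
    have e2 : r ^ d ≤ r ^ p := by
      rw [← Real.rpow_natCast]
      exact Real.rpow_le_rpow_of_exponent_le h1 hp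
    have e3 : (1 / 2 : ℝ) ^ p ≤ 1 := Real.rpow_le_one (by norm_num) (by norm_num) hp0
    calc v * (r + 1 / 2) ^ d * (M * (1 / 2) ^ p)
        ≤ v * ((1 / 2) ^ d * (3 ^ d * r ^ p)) * (M * 1) := by
          gcongr
          exact e1.trans (by gcongr)
      _ = _ := by ring
  calc ∫⁻ z in parabolicCylinder t x r, F z
      ≤ ∫⁻ z in ⋃ k : Fin K, Ioo (k / 8 : ℝ) (k / 8 + 1 / 4) ×ˢ Metric.ball x r, F z := by
        rw [← lintegral_indicator (measurableSet_parabolicCylinder t x r),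
          ← lintegral_indicator (MeasurableSet.iUnion fun k =>
            measurableSet_Ioo.prod Metric.isOpen_ball.measurableSet)]
        refine lintegral_mono fun z => ?_
        by_cases hz : z ∈ parabolicCylinder t x r
        swap
        · rw [indicator_of_notMem hz]; exact zero_le
        rw [indicator_of_mem hz]
        by_cases hT : z.1 ∈ Ioo 0 T
        swap
        · rw [hsupp z hT]; exact zero_le
        rw [indicator_of_mem]
        -- The slab index is `⌈8s⌉ - 1`, for which `k/8 < s ≤ (k+1)/8`.
        have h8 : 0 < 8 * z.1 := by linarith [hT.1]
        have hpos : 0 < ⌈8 * z.1⌉₊ := Nat.ceil_pos.2 h8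
        have hle : ⌈8 * z.1⌉₊ ≤ K := Nat.ceil_le_ceil (by linarith [hT.2])
        refine mem_iUnion.2 ⟨⟨⌈8 * z.1⌉₊ - 1, by omega⟩, ⟨?_, ?_⟩, hz.2⟩
        · have := Nat.ceil_lt_add_one h8.le
          simp only [Nat.cast_sub (Nat.one_le_iff_ne_zero.2 hpos.ne')]
          push_cast
          linarith
        · have := Nat.le_ceil (8 * z.1)
          simp only [Nat.cast_sub (Nat.one_le_iff_ne_zero.2 hpos.ne')]
          push_cast
          linarith
    _ ≤ ∑' k : Fin K, ∫⁻ z in Ioo (k / 8 : ℝ) (k / 8 + 1 / 4) ×ˢ Metric.ball x r, F z :=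
        lintegral_iUnion_le _ _
    _ ≤ ∑' k : Fin K, ENNReal.ofReal (3 ^ d * M * r ^ p) := by
        refine ENNReal.tsum_le_tsum fun k => ?_
        rw [Measure.volume_eq_prod, setLIntegral_prod_symm _ hF.aemeasurable]
        exact hball k
    _ = ENNReal.ofReal (K * (3 ^ d * M * r ^ p)) := by
        rw [tsum_fintype, Finset.sum_const, Finset.card_univ, Fintype.card_fin, nsmul_eq_mul,
          ENNReal.ofReal_mul (Nat.cast_nonneg K), ENNReal.ofReal_natCast]
    _ ≤ _ := by
        refine ENNReal.ofReal_le_ofReal ?_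
        have : 0 ≤ r ^ p := by positivity
        nlinarith

/-- The Cauchy-Schwarz inequality on a set. -/
theorem setLIntegral_mul_le_sqrt {α : Type*} [MeasurableSpace α] {μ : Measure α} (s : Set α)
    {f g : α → ℝ≥0∞} (hf : Measurable f) (hg : Measurable g) :
    ∫⁻ a in s, f a * g a ∂μ ≤
      (∫⁻ a in s, f a ^ 2 ∂μ) ^ (1 / 2 : ℝ) * (∫⁻ a in s, g a ^ 2 ∂μ) ^ (1 / 2 : ℝ) := by
  have := ENNReal.lintegral_mul_le_Lp_mul_Lq (μ.restrict s) Real.HolderConjugate.two_two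
    hf.aemeasurable hg.aemeasurable
  simpa only [Pi.mul_apply, ENNReal.rpow_two] using this

/-- Cauchy-Schwarz against the constant `1`: the exponent is the mean of `p` and the parabolic
dimension `d + 2`. -/
theorem GrowthBound.lintegral_le {d : ℕ} {p M : ℝ} (hM : 0 ≤ M) {N : ℝ × Rd d → ℝ≥0∞}
    (hN : Measurable N) (h : GrowthBound p M fun z => N z ^ 2) {t : ℝ} (ht : 0 ≤ t) (x : Rd d)
    {r : ℝ} (hr : 0 < r) :
    ∫⁻ z in parabolicCylinder t x r, N z ≤
      ENNReal.ofReal (√(M * unitBallVolume d) *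
        r ^ ((p + d + 2) / 2)) := by
  have h1 := setLIntegral_mul_le_sqrt (μ := volume) (parabolicCylinder t x r) hN
    (measurable_const (a := (1 : ℝ≥0∞)))
  simp only [mul_one, one_pow, lintegral_const, one_mul, Measure.restrict_apply_univ] at h1
  refine h1.trans ?_
  rw [volume_parabolicCylinder t x hr, ← ENNReal.mul_rpow_of_nonneg _ _ (by norm_num)]
  calc _ ≤ (ENNReal.ofReal (M * r ^ p) * ENNReal.ofReal (unitBallVolume d
        * r ^ (d + 2))) ^ (1 / 2 : ℝ) := by
        gcongr
        exact h t ht x r hr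
    _ = _ := by
        have hv := (unitBallVolume_pos d).le
        rw [← ENNReal.ofReal_mul (by positivity), ENNReal.ofReal_rpow_of_nonneg (by positivity)
          (by norm_num), ← Real.sqrt_eq_rpow]
        congr 1
        have : M * r ^ p * (unitBallVolume d * r ^ (d + 2)) =
            M * unitBallVolume d * (r ^ ((p + d + 2) / 2)) ^ 2 := by
          rw [← Real.rpow_natCast r (d + 2), ← Real.rpow_natCast (r ^ _) 2, ← Real.rpow_mul hr.le]
          have : (p + d + 2) / 2 * ((2 : ℕ) : ℝ) = p + ((d + 2 : ℕ) : ℝ) := by push_cast; ring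
          rw [this, Real.rpow_add hr]
          ring
        rw [this, Real.sqrt_mul (by positivity), Real.sqrt_sq (by positivity)]

/-! ### Parabolic distance and the far-field sum -/

/-- The parabolic distance to `(t, x)` of points in the future of `t`. -/
noncomputable def parabolicDist {d : ℕ} (t : ℝ) (x : Rd d) (z : ℝ × Rd d) : ℝ :=
  √(z.1 - t) + ‖z.2 - x‖

theorem le_parabolicDist_of_notMem {d : ℕ} {t : ℝ} {x : Rd d} {r : ℝ} {z : ℝ × Rd d}
    (hz : t < z.1) (h : z ∉ parabolicCylinder t x r) : r ≤ parabolicDist t x z := by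
  rw [parabolicCylinder, mem_prod, not_and_or] at h
  unfold parabolicDist
  rcases h with h | h
  · have h1 : t + r ^ 2 ≤ z.1 := by
      by_contra hc
      exact h ⟨hz, not_le.1 hc⟩
    have := Real.le_sqrt_of_sq_le (x := r) (y := z.1 - t) (by linarith)
    linarith [norm_nonneg (z.2 - x)]
  · have : r ≤ ‖z.2 - x‖ := by
      rw [← dist_eq_norm]
      exact not_lt.1 h
    linarith [Real.sqrt_nonneg (z.1 - t)]

/-- Far-field estimate: the parabolic Riesz-type potential of order `d + 2` outside a cylinder. -/
theorem exists_lintegral_far_le {d : ℕ} {p M : ℝ} (hM : 0 ≤ M) (hp : p < d + 2)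
    {N : ℝ × Rd d → ℝ≥0∞} (hN : Measurable N) (h : GrowthBound p M fun z => N z ^ 2) :
    ∃ C : ℝ, 0 ≤ C ∧ ∀ t : ℝ, 0 ≤ t → ∀ (x : Rd d) (r : ℝ), 0 < r →
      ∫⁻ z in {z : ℝ × Rd d | t < z.1} \ parabolicCylinder t x r,
        N z * ENNReal.ofReal ((parabolicDist t x z ^ (d + 2))⁻¹) ≤
      ENNReal.ofReal (C * r ^ ((p + d + 2) / 2 - (d + 2))) := by
  set α := (p + d + 2) / 2 with hα
  set A := √(M * unitBallVolume d)
  have hA : 0 ≤ A := Real.sqrt_nonneg _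
  -- The condition `p < d + 2` enters here: it makes the ratio `2 ^ β` of the dyadic series less
  -- than `1`.
  have hβ : α - (d + 2) < 0 := by rw [hα]; linarith
  set β := α - (d + 2) with hβdef
  set q : ℝ := 2 ^ β
  have hq0 : 0 ≤ q := by positivity
  have hq1 : q < 1 := Real.rpow_lt_one_of_one_lt_of_neg (by norm_num) hβ
  refine ⟨A * 2 ^ α * ∑' k : ℕ, q ^ k, by positivity, fun t ht x r hr => ?_⟩
  -- Dyadic shells. On the `k`-th one the weight is at most `(2^k r)^{-(d+2)}`, while the integral
  -- of `N` is at most `A (2^(k+1) r)^α`.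
  set S : ℕ → Set (ℝ × Rd d) := fun k =>
    ({z | t < z.1} \ parabolicCylinder t x (2 ^ k * r)) ∩ parabolicCylinder t x (2 ^ (k + 1) * r)
  have hmt : MeasurableSet {z : ℝ × Rd d | t < z.1} := measurableSet_lt measurable_const measurable_fst
  have hSm : ∀ k, MeasurableSet (S k) := fun k =>
    (hmt.diff (measurableSet_parabolicCylinder _ _ _)).inter (measurableSet_parabolicCylinder _ _ _)
  have hcover : {z : ℝ × Rd d | t < z.1} \ parabolicCylinder t x r ⊆ ⋃ k, S k := by
    intro z hz
    have hex : ∃ k : ℕ, z ∈ parabolicCylinder t x (2 ^ k * r) := by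
      obtain ⟨k, hk⟩ := pow_unbounded_of_one_lt ((z.1 - t + ‖z.2 - x‖ + 1) / r)
        (one_lt_two (α := ℝ))
      rw [div_lt_iff₀ hr] at hk
      have h1 : t < z.1 := hz.1
      have h2 := norm_nonneg (z.2 - x)
      refine ⟨k, ⟨h1, ?_⟩, ?_⟩
      · nlinarith
      · rw [Metric.mem_ball, dist_eq_norm]
        linarith
    classical
    -- The shell of `z` is one below the first dyadic cylinder containing `z`; that index is
    -- positive because `z` lies outside the cylinder of radius `r`.
    have h0 : Nat.find hex ≠ 0 := fun h0 => hz.2 (by simpa [h0] using Nat.find_spec hex)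
    obtain ⟨k, hk⟩ := Nat.exists_eq_succ_of_ne_zero h0
    refine mem_iUnion.2 ⟨k, ⟨hz.1, ?_⟩, ?_⟩
    · exact Nat.find_min hex (by omega)
    · have := Nat.find_spec hex
      rwa [hk] at this
  calc _ ≤ ∫⁻ z in ⋃ k, S k, N z * ENNReal.ofReal ((parabolicDist t x z ^ (d + 2))⁻¹) :=
        lintegral_mono_set hcover
    _ ≤ ∑' k, ∫⁻ z in S k, N z * ENNReal.ofReal ((parabolicDist t x z ^ (d + 2))⁻¹) :=
        lintegral_iUnion_le _ _
    _ ≤ ∑' k : ℕ, ENNReal.ofReal (A * 2 ^ α * r ^ β * q ^ k) := by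
        refine ENNReal.tsum_le_tsum fun k => ?_
        have hR : 0 < 2 ^ k * r := by positivity
        calc _ ≤ ∫⁻ z in S k, N z * ENNReal.ofReal (((2 ^ k * r) ^ (d + 2))⁻¹) := by
              refine setLIntegral_mono' (hSm k) fun z hz => ?_
              gcongr
              exact le_parabolicDist_of_notMem hz.1.1 hz.1.2
          _ ≤ ∫⁻ z in parabolicCylinder t x (2 ^ (k + 1) * r),
                N z * ENNReal.ofReal (((2 ^ k * r) ^ (d + 2))⁻¹) :=
              lintegral_mono_set inter_subset_right
          _ ≤ ENNReal.ofReal (A * (2 ^ (k + 1) * r) ^ α) *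
                ENNReal.ofReal (((2 ^ k * r) ^ (d + 2))⁻¹) := by
              rw [lintegral_mul_const _ hN]
              gcongr
              exact GrowthBound.lintegral_le hM hN h ht x (by positivity)
          _ = _ := by
              rw [← ENNReal.ofReal_mul (by positivity)]
              congr 1
              have e1 : (2 ^ (k + 1) * r) ^ α = 2 ^ α * (2 ^ k * r) ^ α := by
                rw [← Real.mul_rpow (by norm_num) hR.le]
                congr 1; ring
              have e2 : (2 ^ k * r) ^ α * ((2 ^ k * r) ^ (d + 2))⁻¹ = q ^ k * r ^ β := by
                rw [← Real.rpow_natCast (2 ^ k * r) (d + 2), ← Real.rpow_neg hR.le,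
                  ← Real.rpow_add hR]
                have : α + -((d + 2 : ℕ) : ℝ) = β := by rw [hβdef]; push_cast; ring
                rw [this, Real.mul_rpow (by positivity) hr.le, ← Real.rpow_natCast 2 k,
                  ← Real.rpow_mul (by norm_num), mul_comm (k : ℝ), Real.rpow_mul (by norm_num),
                  Real.rpow_natCast]
              rw [e1, mul_assoc, mul_assoc, e2]
              ring
    _ = _ := by
        rw [← ENNReal.ofReal_tsum_of_nonneg (fun k => by positivity)
          ((summable_geometric_of_lt_one hq0 hq1).mul_left _), tsum_mul_left]
        congr 1
        ring

/-! ### Pointwise bounds for the heat kernel and its derivatives -/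

theorem heatKernel_nonneg {d : ℕ} {τ : ℝ} (hτ : 0 < τ) (x y : Rd d) : 0 ≤ heatKernel d τ x y := by
  unfold heatKernel
  have := Real.pi_pos
  positivity

theorem heatKernel_eq {d : ℕ} {τ : ℝ} (hτ : 0 < τ) (x y : Rd d) :
    heatKernel d τ x y = ((√(2 * Real.pi) * √τ) ^ d)⁻¹ * Real.exp (-(‖x - y‖ / √τ) ^ 2 / 2) := by
  have := Real.pi_pos
  unfold heatKernel
  congr 1
  · rw [← Real.sqrt_mul (by positivity), Real.sqrt_eq_rpow, ← Real.rpow_natCast, ← Real.rpow_mul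
      (by positivity), ← Real.rpow_neg (by positivity)]
    congr 1
    ring
  · rw [div_pow, Real.sq_sqrt hτ.le]
    congr 1
    field_simp

/-- Two elementary bounds multiply: `(1 + a)^n ≤ n! e^(1+a)`, and `-a²/2 ≤ 1/2 - a` because `(a -
1)² ≥ 0`. -/
theorem one_add_pow_mul_exp_le (n : ℕ) {a : ℝ} (ha : 0 ≤ a) :
    (1 + a) ^ n * Real.exp (-a ^ 2 / 2) ≤ n.factorial * Real.exp (3 / 2) := by
  have h1 := Real.pow_div_factorial_le_exp (1 + a) (by positivity) n
  rw [div_le_iff₀ (by positivity)] at h1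
  calc (1 + a) ^ n * Real.exp (-a ^ 2 / 2)
      ≤ (Real.exp (1 + a) * n.factorial) * Real.exp (1 / 2 - a) := by
        gcongr
        nlinarith [sq_nonneg (a - 1)]
    _ = n.factorial * Real.exp (3 / 2) := by
        rw [mul_right_comm, ← Real.exp_add, mul_comm]
        congr 2
        ring

/-- Polynomial decay of the heat kernel in the parabolic variable. -/
theorem exists_heatKernel_mul_pow_le (d n : ℕ) : ∃ C : ℝ, 0 ≤ C ∧ ∀ τ : ℝ, 0 < τ → ∀ x y : Rd d,
    heatKernel d τ x y * (1 + ‖x - y‖ / √τ) ^ n ≤ C * (√τ ^ d)⁻¹ := by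
  refine ⟨((√(2 * Real.pi)) ^ d)⁻¹ * (n.factorial * Real.exp (3 / 2)), by positivity,
    fun τ hτ x y => ?_⟩
  rw [heatKernel_eq hτ, mul_pow, mul_inv]
  have := one_add_pow_mul_exp_le n (a := ‖x - y‖ / √τ) (by positivity)
  calc _ = ((√(2 * Real.pi)) ^ d)⁻¹ * (√τ ^ d)⁻¹ *
        ((1 + ‖x - y‖ / √τ) ^ n * Real.exp (-(‖x - y‖ / √τ) ^ 2 / 2)) := by ring
    _ ≤ ((√(2 * Real.pi)) ^ d)⁻¹ * (√τ ^ d)⁻¹ * (n.factorial * Real.exp (3 / 2)) := by gcongr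
    _ = _ := by ring

/-- The first spatial derivatives of the heat kernel. -/
noncomputable def heatKernelGrad (d : ℕ) (i : Fin d) (τ : ℝ) (x y : Rd d) : ℝ :=
  -((x - y) i / τ) * heatKernel d τ x y

/-- The second spatial derivatives of the heat kernel. -/
noncomputable def heatKernelHess (d : ℕ) (i j : Fin d) (τ : ℝ) (x y : Rd d) : ℝ :=
  ((x - y) i * (x - y) j / τ ^ 2 - (if i = j then 1 / τ else 0)) * heatKernel d τ x y

theorem hasLineDerivAt_heatKernel {d : ℕ} (i : Fin d) (τ : ℝ) (x y : Rd d) :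
    HasLineDerivAt ℝ (fun x => heatKernel d τ x y) (heatKernelGrad d i τ x y) x
      (EuclideanSpace.single i 1) := by
  unfold HasLineDerivAt heatKernelGrad heatKernel
  have h1 : ∀ t : ℝ, ‖x + t • EuclideanSpace.single i (1 : ℝ) - y‖ ^ 2 =
      ‖x - y‖ ^ 2 + 2 * (t * (x - y) i) + t ^ 2 := by
    intro t
    rw [add_sub_right_comm, norm_add_sq_real, inner_smul_right, norm_smul]
    simp [EuclideanSpace.inner_single_right]
  simp_rw [h1]
  have h2 : HasDerivAt (fun t : ℝ => -(‖x - y‖ ^ 2 + 2 * (t * (x - y) i) + t ^ 2) / (2 * τ))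
      (-(2 * (x - y) i) / (2 * τ)) 0 := by
    have := ((((hasDerivAt_id (0 : ℝ)).mul_const ((x - y) i)).const_mul 2).const_add
      (‖x - y‖ ^ 2)).add ((hasDerivAt_id (0 : ℝ)).pow 2)
    convert! this.neg.div_const (2 * τ) using 1
    simp
  convert! h2.exp.const_mul ((2 * Real.pi * τ) ^ (-(d : ℝ) / 2)) using 1
  simp
  ring

theorem hasLineDerivAt_heatKernelGrad {d : ℕ} (i j : Fin d) (τ : ℝ) (x y : Rd d) :
    HasLineDerivAt ℝ (fun x => heatKernelGrad d i τ x y) (heatKernelHess d i j τ x y) x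
      (EuclideanSpace.single j 1) := by
  have h1 := hasLineDerivAt_heatKernel j τ x y
  unfold HasLineDerivAt at h1 ⊢
  unfold heatKernelGrad heatKernelHess
  have h2 : HasDerivAt (fun t : ℝ => -((x + t • EuclideanSpace.single j (1 : ℝ) - y) i / τ))
      (-((if i = j then 1 else 0) / τ)) 0 := by
    have : (fun t : ℝ => -((x + t • EuclideanSpace.single j (1 : ℝ) - y) i / τ)) =
        fun t : ℝ => -(((x - y) i + t * (if i = j then 1 else 0)) / τ) := by
      ext t
      simp [add_sub_right_comm]
    rw [this]
    convert! ((((hasDerivAt_id (0 : ℝ)).mul_const (if i = j then (1 : ℝ) else 0)).const_add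
      ((x - y) i)).div_const τ).neg using 1
    simp
  convert! h2.mul h1 using 1
  simp [heatKernelGrad]
  split_ifs <;> ring

/-- The decay is written with the same weight of order `d + 2` as for the Hessian, at the price of a
factor `τ`, so that one far-field estimate serves both. The factor is harmless on a bounded time
interval. -/
theorem exists_heatKernel_le (d : ℕ) : ∃ C : ℝ, 0 ≤ C ∧ ∀ τ : ℝ, 0 < τ → ∀ x y : Rd d,
    heatKernel d τ x y ≤ C * τ * ((√τ + ‖x - y‖) ^ (d + 2))⁻¹ := by
  obtain ⟨C, hC, h⟩ := exists_heatKernel_mul_pow_le d (d + 2)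
  refine ⟨C, hC, fun τ hτ x y => ?_⟩
  have hs : 0 < √τ := Real.sqrt_pos.2 hτ
  have e : √τ + ‖x - y‖ = √τ * (1 + ‖x - y‖ / √τ) := by field_simp
  rw [← div_eq_mul_inv, le_div_iff₀ (by positivity), e, mul_pow]
  calc _ = (heatKernel d τ x y * (1 + ‖x - y‖ / √τ) ^ (d + 2)) * √τ ^ (d + 2) := by ring
    _ ≤ (C * (√τ ^ d)⁻¹) * √τ ^ (d + 2) :=
        mul_le_mul_of_nonneg_right (h τ hτ x y) (by positivity)
    _ = C * τ := by
        rw [pow_add, Real.sq_sqrt hτ.le]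
        field_simp

theorem abs_apply_le_norm {d : ℕ} (x : Rd d) (i : Fin d) : |x i| ≤ ‖x‖ := by
  simpa using EuclideanSpace.norm_eq x ▸ Real.abs_le_sqrt (by
    simpa using Finset.single_le_sum (f := fun i => x i ^ 2) (fun i _ => sq_nonneg _)
      (Finset.mem_univ i))

/-- With `a = |x - y|/√τ`, the Hessian is at most `(1 + a)²/τ` times the kernel. Of the `d + 4`
available powers of decay, two absorb this polynomial and `d + 2` produce the weight. -/
theorem exists_abs_heatKernelHess_le (d : ℕ) : ∃ C : ℝ, 0 ≤ C ∧ ∀ (i j : Fin d) (τ : ℝ), 0 < τ →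
    ∀ x y : Rd d, |heatKernelHess d i j τ x y| ≤ C * ((√τ + ‖x - y‖) ^ (d + 2))⁻¹ := by
  obtain ⟨C, hC, h⟩ := exists_heatKernel_mul_pow_le d (d + 4)
  refine ⟨C, hC, fun i j τ hτ x y => ?_⟩
  have hs : 0 < √τ := Real.sqrt_pos.2 hτ
  have e : √τ + ‖x - y‖ = √τ * (1 + ‖x - y‖ / √τ) := by field_simp
  rw [← div_eq_mul_inv, le_div_iff₀ (by positivity), e, mul_pow]
  have hq := heatKernel_nonneg hτ x y
  have h1 : |heatKernelHess d i j τ x y| ≤ (1 + ‖x - y‖ / √τ) ^ 2 / τ * heatKernel d τ x y := by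
    rw [heatKernelHess, abs_mul, abs_of_nonneg hq]
    gcongr
    have h2 : |(x - y) i * (x - y) j / τ ^ 2| ≤ ‖x - y‖ ^ 2 / τ ^ 2 := by
      rw [abs_div, abs_mul, abs_of_nonneg (sq_nonneg τ), sq ‖x - y‖]
      gcongr <;> exact abs_apply_le_norm _ _
    have h3 : |(if i = j then 1 / τ else 0)| ≤ 1 / τ := by
      split_ifs
      · rw [abs_of_pos (by positivity)]
      · simpa using hτ.le
    calc _ ≤ ‖x - y‖ ^ 2 / τ ^ 2 + 1 / τ := (abs_sub _ _).trans (add_le_add h2 h3)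
      _ = ((‖x - y‖ / √τ) ^ 2 + 1) / τ := by
          rw [div_pow, Real.sq_sqrt hτ.le]
          field_simp
      _ ≤ _ := by
          gcongr
          have : 0 ≤ ‖x - y‖ / √τ := by positivity
          nlinarith
  calc _ ≤ (1 + ‖x - y‖ / √τ) ^ 2 / τ * heatKernel d τ x y *
        (√τ ^ (d + 2) * (1 + ‖x - y‖ / √τ) ^ (d + 2)) := by gcongr
    _ = (heatKernel d τ x y * (1 + ‖x - y‖ / √τ) ^ (d + 4)) * (√τ ^ (d + 2) / τ) := by ring
    _ ≤ (C * (√τ ^ d)⁻¹) * (√τ ^ (d + 2) / τ) :=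
        mul_le_mul_of_nonneg_right (h τ hτ x y) (by positivity)
    _ = C := by
        rw [pow_add, Real.sq_sqrt hτ.le]
        field_simp

theorem continuous_heatKernel {d : ℕ} (τ : ℝ) (y : Rd d) :
    Continuous fun x => heatKernel d τ x y := by
  unfold heatKernel
  fun_prop

theorem continuous_heatKernelGrad {d : ℕ} (i : Fin d) (τ : ℝ) (y : Rd d) :
    Continuous fun x => heatKernelGrad d i τ x y := by
  unfold heatKernelGrad heatKernel
  fun_prop

theorem continuous_heatKernelHess {d : ℕ} (i j : Fin d) (τ : ℝ) (y : Rd d) :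
    Continuous fun x => heatKernelHess d i j τ x y := by
  unfold heatKernelHess heatKernel
  fun_prop

theorem heatKernel_comm {d : ℕ} (τ : ℝ) (x y : Rd d) : heatKernel d τ x y = heatKernel d τ y x := by
  unfold heatKernel
  rw [norm_sub_rev]

/-! ### The space-time kernel, its Fourier transform and its mass -/

/-- The heat kernel as a kernel on space-time, vanishing unless the time increases. -/
noncomputable def spaceTimeKernel (d : ℕ) (z w : ℝ × Rd d) : ℝ :=
  if z.1 < w.1 then heatKernel d (w.1 - z.1) z.2 w.2 else 0

theorem spaceTimeKernel_nonneg {d : ℕ} (z w : ℝ × Rd d) : 0 ≤ spaceTimeKernel d z w := by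
  unfold spaceTimeKernel
  split_ifs with h
  · exact heatKernel_nonneg (sub_pos.2 h) _ _
  · rfl

theorem measurable_spaceTimeKernel (d : ℕ) :
    Measurable fun q : (ℝ × Rd d) × (ℝ × Rd d) => spaceTimeKernel d q.1 q.2 := by
  unfold spaceTimeKernel heatKernel
  refine Measurable.ite (measurableSet_lt (by fun_prop) (by fun_prop)) ?_ measurable_const
  fun_prop

-- The kernel is a normalized Gaussian translated by `x`: translation contributes the character, and
-- the prefactor cancels the constant of the Gaussian transform.
open FourierTransform in
theorem fourier_heatKernel {d : ℕ} {τ : ℝ} (hτ : 0 < τ) (x ξ : Rd d) :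
    𝓕 (fun y => (heatKernel d τ x y : ℂ)) ξ =
      Real.fourierChar (-(inner ℝ x ξ)) • (Real.exp (-2 * Real.pi ^ 2 * τ * ‖ξ‖ ^ 2) : ℂ) := by
  have hpi := Real.pi_pos
  set c : ℝ := (2 * Real.pi * τ) ^ (-(d : ℝ) / 2) with hc
  set G : Rd d → ℂ := fun v => Complex.exp (-((1 / (2 * τ) : ℝ) : ℂ) * ‖v‖ ^ 2) with hG
  have h1 : (fun y => (heatKernel d τ x y : ℂ)) = (c : ℂ) • (G ∘ fun y => y + -x) := by
    ext y
    simp only [heatKernel, hG, Pi.smul_apply, Function.comp, smul_eq_mul, ← sub_eq_add_neg,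
      norm_sub_rev y x]
    rw [← hc]
    push_cast
    congr 2
    field_simp
  have h2 := fourier_gaussian_innerProductSpace (V := Rd d) (b := ((1 / (2 * τ) : ℝ) : ℂ))
    (by simpa using hτ) ξ
  rw [h1]
  have h3 : 𝓕 ((c : ℂ) • (G ∘ fun y => y + -x)) ξ = (c : ℂ) • 𝓕 (G ∘ fun y => y + -x) ξ := by
    exact congrFun (VectorFourier.fourierIntegral_const_smul _ _ _ _ _) ξ
  have h4 : 𝓕 (G ∘ fun y => y + -x) ξ = Real.fourierChar (inner ℝ (-x) ξ) • 𝓕 G ξ := by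
    exact congrFun (VectorFourier.fourierIntegral_comp_add_right _ _ _ _ _) ξ
  rw [h3, h4, h2, inner_neg_left, smul_comm]
  congr 1
  have h5 : (c : ℂ) * ((Real.pi : ℂ) / ((1 / (2 * τ) : ℝ) : ℂ)) ^
      ((Module.finrank ℝ (Rd d) : ℂ) / 2) = 1 := by
    have : ((Real.pi : ℂ) / ((1 / (2 * τ) : ℝ) : ℂ)) ^ ((Module.finrank ℝ (Rd d) : ℂ) / 2) =
        (((2 * Real.pi * τ) ^ ((d : ℝ) / 2) : ℝ) : ℂ) := by
      rw [Complex.ofReal_cpow (by positivity)]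
      simp only [one_div, mul_inv_rev, Complex.ofReal_mul, Complex.ofReal_inv, Complex.ofReal_ofNat,
        finrank_euclideanSpace, Fintype.card_fin, Complex.ofReal_div, Complex.ofReal_natCast]
      congr 1
      field_simp
    rw [this, ← Complex.ofReal_mul, hc, ← Real.rpow_add (by positivity)]
    simp [neg_div]
  rw [smul_eq_mul, ← mul_assoc, h5, one_mul]
  push_cast
  congr 1
  field_simp

theorem integrable_heatKernel_right {d : ℕ} {τ : ℝ} (hτ : 0 < τ) (x : Rd d) :
    Integrable fun y => heatKernel d τ x y := by
  have h := ((GaussianFourier.integrable_cexp_neg_mul_sq_norm_add (V := Rd d)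
    (b := ((1 / (2 * τ) : ℝ) : ℂ)) (by simpa using hτ) 0 0).comp_sub_left x).norm.const_mul
      ((2 * Real.pi * τ) ^ (-(d : ℝ) / 2))
  refine h.congr (ae_of_all _ fun y => ?_)
  simp only [heatKernel, Complex.norm_exp]
  norm_cast
  simp
  left
  field_simp

/-- The total mass is the value of the Fourier transform at `ξ = 0`. -/
theorem integral_heatKernel_right {d : ℕ} {τ : ℝ} (hτ : 0 < τ) (x : Rd d) :
    ∫ y, heatKernel d τ x y = 1 := by
  have h := fourier_heatKernel hτ x 0
  rw [Real.fourier_eq] at h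
  simp [integral_complex_ofReal] at h
  exact_mod_cast h

theorem lintegral_heatKernel_right {d : ℕ} {τ : ℝ} (hτ : 0 < τ) (x : Rd d) :
    ∫⁻ y, ENNReal.ofReal (heatKernel d τ x y) = 1 := by
  rw [← ofReal_integral_eq_lintegral_ofReal (integrable_heatKernel_right hτ x)
    (ae_of_all _ fun y => heatKernel_nonneg hτ x y), integral_heatKernel_right hτ]
  simp

theorem lintegral_heatKernel_left {d : ℕ} {τ : ℝ} (hτ : 0 < τ) (y : Rd d) :
    ∫⁻ x, ENNReal.ofReal (heatKernel d τ x y) = 1 := by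
  simp_rw [heatKernel_comm τ _ y]
  exact lintegral_heatKernel_right hτ y

/-! ### Plancherel, Young and the heat multiplier -/

open FourierTransform in
/-- On `L¹ ∩ L²` the Fourier transform on `L²` is given by the Fourier integral. -/
theorem coeFn_fourier_toLp_ae_eq {d : ℕ} {f : Rd d → ℂ} (hf : Integrable f) (hf2 : MemLp f 2) :
    (𝓕 (hf2.toLp f) : Lp (α := Rd d) ℂ 2) =ᵐ[volume] 𝓕 f := by
  have hcont : Continuous (𝓕 f) :=
    VectorFourier.fourierIntegral_continuous Real.continuous_fourierChar
      (by exact continuous_inner) hf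
  -- Both sides are tested against smooth compactly supported `g`. The `L²` transform is compatible
  -- with tempered distributions, so it moves onto `g`; self-adjointness of the Fourier integral
  -- moves it back onto `f`.
  refine ae_eq_of_integral_contDiff_smul_eq ?_ hcont.locallyIntegrable fun g hg hgs => ?_
  · exact (Lp.memLp _).locallyIntegrable (by norm_num)
  set G : SchwartzMap (Rd d) ℂ :=
    (hgs.comp_left (g := ((↑) : ℝ → ℂ)) Complex.ofReal_zero).toSchwartzMap
      (Complex.ofRealCLM.contDiff.comp hg) with hG
  have hGg : ∀ x, G x = (g x : ℂ) := fun x => rfl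
  have h1 := congrArg (fun D => D G) (Lp.fourier_toTemperedDistribution_eq (hf2.toLp f))
  simp only [TemperedDistribution.fourier_apply, Lp.toTemperedDistribution_apply] at h1
  have h2 : ∫ x, (𝓕 G) x • (hf2.toLp f) x = ∫ x, (𝓕 G) x • f x := by
    refine integral_congr_ae ?_
    filter_upwards [hf2.coeFn_toLp] with x hx
    rw [hx]
  have h3 : ∫ ξ, 𝓕 (G : Rd d → ℂ) ξ • f ξ = ∫ x, G x • 𝓕 f x := by
    have := VectorFourier.integral_fourierIntegral_smul_eq_flip (μ := volume) (ν := volume)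
      (L := innerₗ (Rd d)) (f := (G : Rd d → ℂ)) (g := f) Real.continuous_fourierChar
      (by exact continuous_inner) G.integrable hf
    rw [flip_innerₗ] at this
    exact this
  rw [h2] at h1
  rw [SchwartzMap.fourier_coe, h3] at h1
  simp only [hGg] at h1
  simpa only [Complex.real_smul, smul_eq_mul] using h1.symm

open FourierTransform in
/-- **Plancherel's theorem** for functions in `L¹ ∩ L²`. -/
theorem lintegral_enorm_fourier_sq {d : ℕ} {f : Rd d → ℂ} (hf : Integrable f) (hf2 : MemLp f 2) :
    ∫⁻ ξ, ‖𝓕 f ξ‖ₑ ^ 2 = ∫⁻ x, ‖f x‖ₑ ^ 2 := by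
  have h1 : eLpNorm (𝓕 f) 2 volume = eLpNorm f 2 volume := by
    rw [← eLpNorm_congr_ae (coeFn_fourier_toLp_ae_eq hf hf2), ← eLpNorm_congr_ae hf2.coeFn_toLp,
      ← Lp.enorm_def, ← Lp.enorm_def, ← ofReal_norm, ← ofReal_norm, Lp.norm_fourier_eq]
  rw [eLpNorm_eq_lintegral_rpow_enorm_toReal (by norm_num) (by norm_num),
    eLpNorm_eq_lintegral_rpow_enorm_toReal (by norm_num) (by norm_num)] at h1
  have h2 := congrArg (fun a => a ^ (2 : ℝ)) h1
  have e : ∀ a : ℝ≥0∞, (a ^ (2⁻¹ : ℝ)) ^ 2 = a := fun a => by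
    rw [← ENNReal.rpow_two, ← ENNReal.rpow_mul]
    norm_num
  simpa [e] using h2

/-- **Young's convolution inequality** `L¹ * L² → L²` on the line. -/
theorem lintegral_convolution_sq_le {k f : ℝ → ℝ≥0∞} (hk : Measurable k) (hf : Measurable f) :
    ∫⁻ s, (∫⁻ t, k (s - t) * f t) ^ 2 ≤ (∫⁻ t, k t) ^ 2 * ∫⁻ t, f t ^ 2 := by
  -- Cauchy-Schwarz with `k = k^{1/2} k^{1/2}`; afterwards Tonelli and translation invariance finish
  -- the proof.
  have h1 : ∀ s, (∫⁻ t, k (s - t) * f t) ^ 2 ≤ (∫⁻ t, k t) * ∫⁻ t, k (s - t) * f t ^ 2 := by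
    intro s
    have hks : Measurable fun t => k (s - t) := hk.comp (measurable_const.sub measurable_id)
    have h := setLIntegral_mul_le_sqrt (μ := volume) univ
      (f := fun t => k (s - t) ^ (1 / 2 : ℝ)) (g := fun t => k (s - t) ^ (1 / 2 : ℝ) * f t)
      (hks.pow_const _) ((hks.pow_const _).mul hf)
    have e : ∀ a : ℝ≥0∞, (a ^ (1 / 2 : ℝ)) ^ 2 = a := fun a => by
      rw [← ENNReal.rpow_two, ← ENNReal.rpow_mul]
      norm_num
    have e' : ∀ a : ℝ≥0∞, a ^ (1 / 2 : ℝ) * a ^ (1 / 2 : ℝ) = a := fun a => by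
      rw [← sq, e]
    simp only [Measure.restrict_univ, ← mul_assoc, e', mul_pow, e] at h
    rw [lintegral_sub_left_eq_self] at h
    calc _ ≤ ((∫⁻ t, k t) ^ (1 / 2 : ℝ) * (∫⁻ t, k (s - t) * f t ^ 2) ^ (1 / 2 : ℝ)) ^ 2 := by
          gcongr
      _ = _ := by rw [mul_pow, e, e]
  have hm : Measurable fun q : ℝ × ℝ => k (q.1 - q.2) * f q.2 ^ 2 :=
    (hk.comp (measurable_fst.sub measurable_snd)).mul ((hf.comp measurable_snd).pow_const 2)
  calc _ ≤ ∫⁻ s, (∫⁻ t, k t) * ∫⁻ t, k (s - t) * f t ^ 2 := lintegral_mono h1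
    _ = (∫⁻ t, k t) * ∫⁻ s, ∫⁻ t, k (s - t) * f t ^ 2 :=
        lintegral_const_mul _ hm.lintegral_prod_right'
    _ = (∫⁻ t, k t) * ∫⁻ t, ∫⁻ s, k (s - t) * f t ^ 2 := by
        rw [lintegral_lintegral_swap hm.aemeasurable]
    _ = (∫⁻ t, k t) * ∫⁻ t, (∫⁻ s, k s) * f t ^ 2 := by
        congr 1
        refine lintegral_congr fun t => ?_
        rw [lintegral_mul_const _ (by fun_prop), lintegral_sub_right_eq_self]
    _ = _ := by
        rw [lintegral_const_mul _ (hf.pow_const 2), ← mul_assoc, sq]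

/-- The multiplier `2 · 2π²|ξ|² e^{-2π²τ|ξ|²}` of second derivatives of the heat semigroup. -/
noncomputable def heatMultiplier (a τ : ℝ) : ℝ≥0∞ :=
  if 0 < τ then ENNReal.ofReal (4 * Real.pi ^ 2 * a ^ 2 * Real.exp (-2 * Real.pi ^ 2 * τ * a ^ 2))
  else 0

theorem measurable_heatMultiplier : Measurable fun q : ℝ × ℝ => heatMultiplier q.1 q.2 := by
  unfold heatMultiplier
  refine Measurable.ite (measurableSet_lt measurable_const measurable_snd) ?_ measurable_const
  fun_prop

/-- With `c = 2π²a²` the integrand is `2c e^{-cτ}`, whose integral over `τ > 0` is `2` for every `c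
> 0`. This independence of the frequency is what makes the `L²` estimate work. -/
theorem lintegral_heatMultiplier_le (a : ℝ) : ∫⁻ τ, heatMultiplier a τ ≤ 2 := by
  have hpi := Real.pi_pos
  have h0 : heatMultiplier a = (Ioi 0).indicator fun τ => ENNReal.ofReal
      (4 * Real.pi ^ 2 * a ^ 2 * Real.exp (-2 * Real.pi ^ 2 * τ * a ^ 2)) := by
    ext τ
    simp [heatMultiplier, indicator]
  rw [h0, lintegral_indicator measurableSet_Ioi]
  rcases eq_or_ne a 0 with rfl | ha
  · simp
  set c := 2 * Real.pi ^ 2 * a ^ 2 with hc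
  have hcpos : 0 < c := by positivity
  have h1 : ∀ τ, 4 * Real.pi ^ 2 * a ^ 2 * Real.exp (-2 * Real.pi ^ 2 * τ * a ^ 2) =
      2 * c * Real.exp (-c * τ) := by
    intro τ
    rw [hc]
    congr 1
    · ring
    · congr 1; ring
  simp_rw [h1]
  rw [← ofReal_integral_eq_lintegral_ofReal
    ((integrableOn_exp_mul_Ioi (neg_lt_zero.2 hcpos) 0).const_mul _)
    (ae_of_all _ fun τ => by positivity), integral_const_mul,
    integral_exp_mul_Ioi (neg_lt_zero.2 hcpos)]
  have : 2 * c * (-Real.exp (-c * 0) / -c) = 2 := by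
    simp
    field_simp
  rw [this]
  norm_num

/-! ### Spatial derivatives of test functions -/

theorem spatialPartial_eq_fderiv {d : ℕ} (i : Fin d) {φ : ℝ × Rd d → ℝ} (hφ : ContDiff ℝ ∞ φ) :
    spatialPartial i φ = fun z => fderiv ℝ φ z (0, EuclideanSpace.single i 1) := by
  ext z
  exact (hφ.differentiable (by simp) z).lineDeriv_eq_fderiv

theorem contDiff_spatialPartial {d : ℕ} (i : Fin d) {φ : ℝ × Rd d → ℝ} (hφ : ContDiff ℝ ∞ φ) :
    ContDiff ℝ ∞ (spatialPartial i φ) := by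
  rw [spatialPartial_eq_fderiv i hφ]
  exact (hφ.fderiv_right (m := ∞) (by simp)).clm_apply contDiff_const

theorem tsupport_spatialPartial_subset {d : ℕ} (i : Fin d) {φ : ℝ × Rd d → ℝ}
    (hφ : ContDiff ℝ ∞ φ) : tsupport (spatialPartial i φ) ⊆ tsupport φ := by
  refine closure_minimal (fun z hz => ?_) (isClosed_tsupport φ)
  refine support_fderiv_subset ℝ (f := φ) fun h => hz ?_
  rw [spatialPartial_eq_fderiv i hφ]
  simp [h]

theorem hasCompactSupport_spatialPartial {d : ℕ} (i : Fin d) {φ : ℝ × Rd d → ℝ}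
    (hφ : ContDiff ℝ ∞ φ) (hs : HasCompactSupport φ) : HasCompactSupport (spatialPartial i φ) :=
  hs.mono' ((subset_tsupport _).trans (tsupport_spatialPartial_subset i hφ))

theorem hasLineDerivAt_slice {d : ℕ} (i : Fin d) {φ : ℝ × Rd d → ℝ} (hφ : ContDiff ℝ ∞ φ) (t : ℝ)
    (x : Rd d) :
    HasLineDerivAt ℝ (fun x => φ (t, x)) (spatialPartial i φ (t, x)) x
      (EuclideanSpace.single i 1) := by
  have h := ((hφ.differentiable (by simp) (t, x)).lineDifferentiableAt
    (v := ((0 : ℝ), EuclideanSpace.single i (1 : ℝ)))).hasLineDerivAt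
  unfold HasLineDerivAt at h ⊢
  simpa [spatialPartial] using h

theorem contDiff_slice {d : ℕ} {φ : ℝ × Rd d → ℝ} (hφ : ContDiff ℝ ∞ φ) (t : ℝ) :
    ContDiff ℝ ∞ fun x => φ (t, x) :=
  hφ.comp (contDiff_const.prodMk contDiff_id)

theorem hasCompactSupport_slice {d : ℕ} {φ : ℝ × Rd d → ℝ} (hs : HasCompactSupport φ) (t : ℝ) :
    HasCompactSupport fun x => φ (t, x) := by
  refine HasCompactSupport.of_support_subset_isCompact (hs.image continuous_snd) fun x hx => ?_
  exact ⟨(t, x), subset_tsupport _ hx, rfl⟩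

-- Differentiation multiplies the transform by `2πi ξᵢ`. Only the modulus is kept, with `|ξᵢ| ≤
-- |ξ|`.
open FourierTransform in
theorem norm_fourier_spatialPartial_le {d : ℕ} (i : Fin d) {φ : ℝ × Rd d → ℝ}
    (hφ : ContDiff ℝ ∞ φ) (hs : HasCompactSupport φ) (t : ℝ) (ξ : Rd d) :
    ‖𝓕 (fun x => (spatialPartial i φ (t, x) : ℂ)) ξ‖ ≤
      2 * Real.pi * ‖ξ‖ * ‖𝓕 (fun x => (φ (t, x) : ℂ)) ξ‖ := by
  set f : Rd d → ℂ := fun x => (φ (t, x) : ℂ) with hf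
  have hfc : ContDiff ℝ ∞ f := Complex.ofRealCLM.contDiff.comp (contDiff_slice hφ t)
  have hfs : HasCompactSupport f :=
    (hasCompactSupport_slice hs t).comp_left (g := ((↑) : ℝ → ℂ)) Complex.ofReal_zero
  have hi : Integrable f := hfc.continuous.integrable_of_hasCompactSupport hfs
  have hi' : Integrable (fderiv ℝ f) :=
    (hfc.continuous_fderiv (by simp)).integrable_of_hasCompactSupport (hfs.fderiv ℝ)
  have h1 : (fun x => (spatialPartial i φ (t, x) : ℂ)) =
      fun x => fderiv ℝ f x (EuclideanSpace.single i 1) := by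
    ext x
    have h2 := ((hfc.differentiable (by simp) x).hasFDerivAt.hasLineDerivAt
      (EuclideanSpace.single i (1 : ℝ)))
    have h3 : HasLineDerivAt ℝ f (spatialPartial i φ (t, x) : ℂ) x (EuclideanSpace.single i 1) :=
      HasDerivAt.ofReal_comp (hasLineDerivAt_slice i hφ t x)
    exact h3.unique h2
  have h4 := congrFun (Real.fourier_fderiv hi (hfc.differentiable (by simp)) hi') ξ
  have h5 := congrArg (fun A => A (EuclideanSpace.single i (1 : ℝ))) h4
  have h6 : (𝓕 (fderiv ℝ f) ξ) (EuclideanSpace.single i (1 : ℝ)) =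
      𝓕 (fun x => fderiv ℝ f x (EuclideanSpace.single i 1)) ξ :=
    Real.fourierIntegral_continuousLinearMap_apply' (L := innerSL ℝ) hi'
  simp only [h6] at h5
  rw [h1, h5, VectorFourier.fourierSMulRight_apply]
  have h7 : ‖(-innerSL ℝ) ξ (EuclideanSpace.single i (1 : ℝ))‖ ≤ ‖ξ‖ := by
    have : (-innerSL ℝ) ξ (EuclideanSpace.single i (1 : ℝ)) =
      -inner ℝ ξ (EuclideanSpace.single i (1 : ℝ)) := rfl
    rw [this, EuclideanSpace.inner_single_right]
    simpa using abs_apply_le_norm ξ i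
  rw [norm_smul, norm_smul, mul_assoc (2 * Real.pi)]
  have h8 : ‖-(2 * (Real.pi : ℂ) * Complex.I)‖ = 2 * Real.pi := by
    simp [abs_of_pos Real.pi_pos]
  rw [h8]
  have := Real.pi_pos
  gcongr

/-! ### Heat potentials: size, integrability and the global `L²` bound -/

/-- The forward heat potential of a function on space-time. -/
noncomputable def heatPotential {d : ℕ} (Φ : ℝ × Rd d → ℝ) (w : ℝ × Rd d) : ℝ :=
  ∫ z, spaceTimeKernel d z w * Φ z

theorem measurable_heatPotential {d : ℕ} {Φ : ℝ × Rd d → ℝ} (hΦ : Measurable Φ) :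
    Measurable (heatPotential Φ) := by
  have h : StronglyMeasurable fun q : (ℝ × Rd d) × (ℝ × Rd d) =>
      spaceTimeKernel d q.2 q.1 * Φ q.2 :=
    (((measurable_spaceTimeKernel d).comp measurable_swap).mul
      (hΦ.comp measurable_snd)).stronglyMeasurable
  exact h.integral_prod_right.measurable

theorem lintegral_spaceTimeKernel_left_le {d : ℕ} (w : ℝ × Rd d) (t : ℝ) :
    ∫⁻ x, ENNReal.ofReal (spaceTimeKernel d (t, x) w) ≤ 1 := by
  unfold spaceTimeKernel
  by_cases h : t < w.1
  · simp only [h, if_true]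
    exact (lintegral_heatKernel_left (sub_pos.2 h) _).le
  · simp [h]

theorem lintegral_spaceTimeKernel_right_le {d : ℕ} (z : ℝ × Rd d) (s : ℝ) :
    ∫⁻ y, ENNReal.ofReal (spaceTimeKernel d z (s, y)) ≤ 1 := by
  unfold spaceTimeKernel
  by_cases h : z.1 < s
  · simp only [h, if_true]
    exact (lintegral_heatKernel_right (sub_pos.2 h) _).le
  · simp [h]

theorem measurable_ofReal_spaceTimeKernel_left {d : ℕ} (w : ℝ × Rd d) :
    Measurable fun z => ENNReal.ofReal (spaceTimeKernel d z w) :=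
  ((measurable_spaceTimeKernel d).comp (measurable_id.prodMk measurable_const)).ennreal_ofReal

/-- At each time the kernel has spatial mass at most `1`, so only the height of `Φ` and the length
of its time support enter. -/
theorem lintegral_spaceTimeKernel_mul_le {d : ℕ} {Φ : ℝ × Rd d → ℝ}
    {J : Set ℝ} (hJ : MeasurableSet J) {B : ℝ≥0∞}
    (h : ∀ z, ‖Φ z‖ₑ ≤ J.indicator (fun _ => B) z.1) (w : ℝ × Rd d) :
    ∫⁻ z, ENNReal.ofReal (spaceTimeKernel d z w) * ‖Φ z‖ₑ ≤ B * volume J := by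
  calc _ ≤ ∫⁻ z : ℝ × Rd d, ENNReal.ofReal (spaceTimeKernel d z w) *
        J.indicator (fun _ => B) z.1 := by
        gcongr with z
        exact h z
    _ = ∫⁻ t, ∫⁻ x, ENNReal.ofReal (spaceTimeKernel d (t, x) w) * J.indicator (fun _ => B) t := by
        rw [Measure.volume_eq_prod, lintegral_prod]
        exact ((measurable_ofReal_spaceTimeKernel_left w).mul
          ((measurable_const.indicator hJ).comp measurable_fst)).aemeasurable
    _ ≤ ∫⁻ t, J.indicator (fun _ => B) t := by
        refine lintegral_mono fun t => ?_
        have hm : Measurable fun x => ENNReal.ofReal (spaceTimeKernel d (t, x) w) :=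
          (measurable_ofReal_spaceTimeKernel_left w).comp (measurable_const.prodMk measurable_id)
        rw [lintegral_mul_const _ hm]
        exact (mul_le_mul_left (lintegral_spaceTimeKernel_left_le w t) _).trans (one_mul _).le
    _ = _ := by rw [lintegral_indicator hJ, setLIntegral_const]

theorem exists_enorm_le_indicator {d : ℕ} {Φ : ℝ × Rd d → ℝ} (hc : Continuous Φ)
    (hs : HasCompactSupport Φ) : ∃ a b B : ℝ, 0 ≤ B ∧
      ∀ z, ‖Φ z‖ₑ ≤ (Icc a b).indicator (fun _ => ENNReal.ofReal B) z.1 := by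
  obtain ⟨B, hB⟩ := hc.bounded_above_of_compact_support hs
  obtain ⟨R, hR⟩ := hs.isBounded.subset_closedBall (0 : ℝ × Rd d)
  refine ⟨-R, R, |B|, abs_nonneg _, fun z => ?_⟩
  by_cases hz : Φ z = 0
  · simp [hz]
  have h1 := hR (subset_tsupport _ hz)
  rw [mem_closedBall_zero_iff] at h1
  have h2 : |z.1| ≤ R := (norm_fst_le z).trans h1
  rw [indicator_of_mem (mem_Icc.2 (abs_le.1 h2)), ← ofReal_norm]
  exact ENNReal.ofReal_le_ofReal ((hB z).trans (le_abs_self B))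

theorem enorm_spaceTimeKernel_mul {d : ℕ} (Φ : ℝ × Rd d → ℝ) (z w : ℝ × Rd d) :
    ‖spaceTimeKernel d z w * Φ z‖ₑ = ENNReal.ofReal (spaceTimeKernel d z w) * ‖Φ z‖ₑ := by
  rw [enorm_mul, Real.enorm_of_nonneg (spaceTimeKernel_nonneg z w)]

theorem integrable_spaceTimeKernel_mul {d : ℕ} {Φ : ℝ × Rd d → ℝ} (hc : Continuous Φ)
    (hs : HasCompactSupport Φ) (w : ℝ × Rd d) :
    Integrable fun z => spaceTimeKernel d z w * Φ z := by
  obtain ⟨a, b, B, hB, h⟩ := exists_enorm_le_indicator hc hs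
  refine ⟨(((measurable_spaceTimeKernel d).comp (measurable_id.prodMk measurable_const)).mul
    hc.measurable).aestronglyMeasurable, ?_⟩
  refine lt_of_le_of_lt ?_ (ENNReal.mul_lt_top (ENNReal.ofReal_lt_top (r := B))
    (measure_Icc_lt_top (a := a) (b := b) (μ := volume)))
  simp only [enorm_spaceTimeKernel_mul]
  exact lintegral_spaceTimeKernel_mul_le measurableSet_Icc h w

theorem exists_enorm_heatPotential_le {d : ℕ} {Φ : ℝ × Rd d → ℝ} (hc : Continuous Φ)
    (hs : HasCompactSupport Φ) : ∃ B : ℝ, ∀ w, ‖heatPotential Φ w‖ ≤ B := by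
  obtain ⟨a, b, B, hB, h⟩ := exists_enorm_le_indicator hc hs
  refine ⟨(ENNReal.ofReal B * volume (Icc a b)).toReal, fun w => ?_⟩
  rw [← toReal_enorm]
  refine ENNReal.toReal_mono (ENNReal.mul_lt_top (ENNReal.ofReal_lt_top (r := B))
    (measure_Icc_lt_top (a := a) (b := b) (μ := volume))).ne ?_
  refine (enorm_integral_le_lintegral_enorm _).trans ?_
  simp only [enorm_spaceTimeKernel_mul]
  exact lintegral_spaceTimeKernel_mul_le measurableSet_Icc h w

theorem integrable_spaceTimeKernel_mul_prod {d : ℕ} {Φ : ℝ × Rd d → ℝ} (hc : Continuous Φ)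
    (hs : HasCompactSupport Φ) (s : ℝ) :
    Integrable (fun q : Rd d × (ℝ × Rd d) => spaceTimeKernel d q.2 (s, q.1) * Φ q.2)
      (volume.prod volume) := by
  have hm : Measurable fun q : Rd d × (ℝ × Rd d) => spaceTimeKernel d q.2 (s, q.1) :=
    (measurable_spaceTimeKernel d).comp
      (measurable_snd.prodMk (measurable_const.prodMk measurable_fst))
  refine ⟨(hm.mul (hc.measurable.comp measurable_snd)).aestronglyMeasurable, ?_⟩
  simp only [HasFiniteIntegral, enorm_spaceTimeKernel_mul]
  have hm' : Measurable fun q : Rd d × (ℝ × Rd d) =>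
      ENNReal.ofReal (spaceTimeKernel d q.2 (s, q.1)) * ‖Φ q.2‖ₑ :=
    hm.ennreal_ofReal.mul (hc.measurable.comp measurable_snd).enorm
  rw [lintegral_prod_symm' _ hm']
  refine lt_of_le_of_lt (lintegral_mono fun z => ?_)
    (hc.integrable_of_hasCompactSupport hs (μ := volume)).2
  have hmz : Measurable fun y => ENNReal.ofReal (spaceTimeKernel d z (s, y)) :=
    hm.ennreal_ofReal.comp (measurable_id.prodMk measurable_const)
  dsimp only
  rw [lintegral_mul_const _ hmz]
  exact (mul_le_mul_left (lintegral_spaceTimeKernel_right_le z s) _).trans (one_mul _).le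

theorem integrable_heatPotential_slice {d : ℕ} {Φ : ℝ × Rd d → ℝ} (hc : Continuous Φ)
    (hs : HasCompactSupport Φ) (s : ℝ) : Integrable fun y => heatPotential Φ (s, y) :=
  (integrable_spaceTimeKernel_mul_prod hc hs s).integral_prod_left

/-- A bounded integrable function is square integrable. Together with integrability this provides
the hypotheses of Plancherel's theorem on each time slice. -/
theorem memLp_two_heatPotential_slice {d : ℕ} {Φ : ℝ × Rd d → ℝ} (hc : Continuous Φ)
    (hs : HasCompactSupport Φ) (s : ℝ) : MemLp (fun y => heatPotential Φ (s, y)) 2 := by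
  obtain ⟨B, hB⟩ := exists_enorm_heatPotential_le hc hs
  have hi := integrable_heatPotential_slice hc hs s
  rw [memLp_two_iff_integrable_sq hi.aestronglyMeasurable]
  simp only [sq]
  exact hi.bdd_mul hi.aestronglyMeasurable (ae_of_all _ fun y => hB (s, y))

open FourierTransform in
/-- The spatial Fourier transform of a heat potential. -/
theorem fourier_heatPotential {d : ℕ} {Φ : ℝ × Rd d → ℝ} (hc : Continuous Φ)
    (hs : HasCompactSupport Φ) (s : ℝ) (ξ : Rd d) :
    𝓕 (fun y => (heatPotential Φ (s, y) : ℂ)) ξ =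
      ∫ t, (if t < s then (Real.exp (-2 * Real.pi ^ 2 * (s - t) * ‖ξ‖ ^ 2) : ℂ) else 0) *
        𝓕 (fun x => (Φ (t, x) : ℂ)) ξ := by
  have hprod := (integrable_spaceTimeKernel_mul_prod hc hs s).ofReal (𝕜 := ℂ)
  have hchar : Continuous fun q : Rd d × (ℝ × Rd d) => Real.fourierChar (-(inner ℝ q.1 ξ)) :=
    Real.continuous_fourierChar.comp (by fun_prop)
  have hI : Integrable (fun q : Rd d × (ℝ × Rd d) => Real.fourierChar (-(inner ℝ q.1 ξ)) •
      ((spaceTimeKernel d q.2 (s, q.1) * Φ q.2 : ℝ) : ℂ)) (volume.prod volume) := by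
    refine (integrable_norm_iff ?_).1 ?_
    · exact (hchar.aestronglyMeasurable).smul hprod.aestronglyMeasurable
    · simp only [Circle.norm_smul]
      exact hprod.norm
  have h1 : 𝓕 (fun y => (heatPotential Φ (s, y) : ℂ)) ξ =
      ∫ z, ∫ y, Real.fourierChar (-(inner ℝ y ξ)) •
        ((spaceTimeKernel d z (s, y) * Φ z : ℝ) : ℂ) := by
    rw [← integral_integral_swap hI, Real.fourier_eq]
    refine integral_congr_ae (ae_of_all _ fun y => ?_)
    simp only [heatPotential]
    rw [← integral_complex_ofReal]
    simp only [Circle.smul_def]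
    rw [integral_smul]
  have h2 : ∀ z : ℝ × Rd d, ∫ y, Real.fourierChar (-(inner ℝ y ξ)) •
        ((spaceTimeKernel d z (s, y) * Φ z : ℝ) : ℂ) =
      (if z.1 < s then (Real.exp (-2 * Real.pi ^ 2 * (s - z.1) * ‖ξ‖ ^ 2) : ℂ) else 0) *
        (Real.fourierChar (-(inner ℝ z.2 ξ)) • (Φ z : ℂ)) := by
    intro z
    by_cases hz : z.1 < s
    · have h3 := fourier_heatKernel (sub_pos.2 hz) z.2 ξ
      rw [Real.fourier_eq] at h3
      simp only [spaceTimeKernel, hz, if_true, Complex.ofReal_mul]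
      have h4 : ∀ y, Real.fourierChar (-(inner ℝ y ξ)) •
          ((heatKernel d (s - z.1) z.2 y : ℂ) * (Φ z : ℂ)) =
          (Real.fourierChar (-(inner ℝ y ξ)) • (heatKernel d (s - z.1) z.2 y : ℂ)) * (Φ z : ℂ) :=
        fun y => (smul_mul_assoc _ _ _).symm
      simp_rw [h4]
      rw [integral_mul_const, h3]
      simp only [Circle.smul_def, smul_eq_mul]
      ring
    · simp [spaceTimeKernel, hz]
  rw [h1]
  simp_rw [h2]
  have hI2 : Integrable (fun z : ℝ × Rd d =>
      (if z.1 < s then (Real.exp (-2 * Real.pi ^ 2 * (s - z.1) * ‖ξ‖ ^ 2) : ℂ) else 0) *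
        (Real.fourierChar (-(inner ℝ z.2 ξ)) • (Φ z : ℂ))) (volume.prod volume) := by
    have := hI.integral_prod_right
    simp only [h2] at this
    exact this
  rw [Measure.volume_eq_prod, integral_prod _ hI2]
  refine integral_congr_ae (ae_of_all _ fun t => ?_)
  simp only
  rw [integral_const_mul, Real.fourier_eq]

open FourierTransform in
theorem measurable_fourier_slice {d : ℕ} {φ : ℝ × Rd d → ℝ} (hφ : Measurable φ) :
    Measurable fun q : ℝ × Rd d => 𝓕 (fun x => (φ (q.1, x) : ℂ)) q.2 := by
  have hm : Measurable fun q : (ℝ × Rd d) × Rd d =>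
      (Real.fourierChar (-(inner ℝ q.2 q.1.2)) : ℂ) * (φ (q.1.1, q.2) : ℂ) := by
    refine Measurable.mul ?_ ?_
    · exact (continuous_subtype_val.comp (Real.continuous_fourierChar.comp
        (by fun_prop : Continuous fun q : (ℝ × Rd d) × Rd d => -(inner ℝ q.2 q.1.2)))).measurable
    · exact Complex.measurable_ofReal.comp
        (hφ.comp ((measurable_fst.comp measurable_fst).prodMk measurable_snd))
  exact hm.stronglyMeasurable.integral_prod_right.measurable

open FourierTransform in
/-- `L²` bound for second derivatives of heat potentials. -/
theorem lintegral_heatPotential_spatialPartial_sq_le {d : ℕ} (i j : Fin d) {φ : ℝ × Rd d → ℝ}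
    (hφ : ContDiff ℝ ∞ φ) (hs : HasCompactSupport φ) :
    ∫⁻ w, ‖heatPotential (spatialPartial i (spatialPartial j φ)) w‖ₑ ^ 2 ≤
      4 * ∫⁻ z, ‖φ z‖ₑ ^ 2 := by
  set Φ := spatialPartial i (spatialPartial j φ) with hΦdef
  have hjs := hasCompactSupport_spatialPartial j hφ hs
  have hjc := contDiff_spatialPartial j hφ
  have hΦc : Continuous Φ := (contDiff_spatialPartial i hjc).continuous
  have hΦs : HasCompactSupport Φ := hasCompactSupport_spatialPartial i hjc hjs
  set a : ℝ × Rd d → ℝ≥0∞ := fun q => ‖𝓕 (fun x => (φ (q.1, x) : ℂ)) q.2‖ₑ with ha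
  have ham : Measurable a := (measurable_fourier_slice hφ.continuous.measurable).enorm
  -- Plancherel at a fixed time. Each spatial derivative costs a factor `2π|ξ|`, so the transform of
  -- the potential is dominated by a convolution in time with `heatMultiplier`.
  have hpl : ∀ s, ∫⁻ y, ‖heatPotential Φ (s, y)‖ₑ ^ 2 ≤
      ∫⁻ ξ, (∫⁻ t, heatMultiplier ‖ξ‖ (s - t) * a (t, ξ)) ^ 2 := by
    intro s
    have h1 := lintegral_enorm_fourier_sq (f := fun y => (heatPotential Φ (s, y) : ℂ))
      (integrable_heatPotential_slice hΦc hΦs s).ofReal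
      (memLp_two_heatPotential_slice hΦc hΦs s).ofReal
    have h2 : ∀ y, ‖(heatPotential Φ (s, y) : ℂ)‖ₑ = ‖heatPotential Φ (s, y)‖ₑ := fun y => by
      rw [← ofReal_norm, ← ofReal_norm, Complex.norm_real]
    simp only [h2] at h1
    rw [← h1]
    gcongr with ξ
    rw [fourier_heatPotential hΦc hΦs]
    refine (enorm_integral_le_lintegral_enorm _).trans (lintegral_mono fun t => ?_)
    by_cases hts : t < s
    · simp only [heatMultiplier, sub_pos, hts, if_true, ha]
      rw [enorm_mul, ← ofReal_norm, ← ofReal_norm, ← ofReal_norm,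
        ← ENNReal.ofReal_mul (norm_nonneg _), ← ENNReal.ofReal_mul (by positivity)]
      refine ENNReal.ofReal_le_ofReal ?_
      rw [Complex.norm_real, Real.norm_of_nonneg (Real.exp_pos _).le]
      have h3 := norm_fourier_spatialPartial_le i hjc hjs t ξ
      have h4 := norm_fourier_spatialPartial_le j hφ hs t ξ
      have := Real.pi_pos
      calc _ ≤ Real.exp (-2 * Real.pi ^ 2 * (s - t) * ‖ξ‖ ^ 2) * (2 * Real.pi * ‖ξ‖ *
            (2 * Real.pi * ‖ξ‖ * ‖𝓕 (fun x => (φ (t, x) : ℂ)) ξ‖)) := by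
            gcongr
            exact h3.trans (by gcongr)
        _ = _ := by ring
    · simp [hts]
  have hm3 : Measurable fun q : (ℝ × Rd d) × ℝ =>
      heatMultiplier ‖q.1.2‖ (q.1.1 - q.2) * a (q.2, q.1.2) := by
    refine Measurable.mul ?_ (ham.comp (by fun_prop))
    exact measurable_heatMultiplier.comp
      (((measurable_snd.comp measurable_fst).norm).prodMk (by fun_prop))
  have hm2 : Measurable fun q : ℝ × Rd d =>
      (∫⁻ t, heatMultiplier ‖q.2‖ (q.1 - t) * a (t, q.2)) ^ 2 :=
    hm3.lintegral_prod_right'.pow_const 2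
  have hΦm := measurable_heatPotential hΦc.measurable
  calc ∫⁻ w, ‖heatPotential Φ w‖ₑ ^ 2 = ∫⁻ s, ∫⁻ y, ‖heatPotential Φ (s, y)‖ₑ ^ 2 := by
        rw [Measure.volume_eq_prod, lintegral_prod _ (hΦm.enorm.pow_const 2).aemeasurable]
    _ ≤ ∫⁻ s, ∫⁻ ξ, (∫⁻ t, heatMultiplier ‖ξ‖ (s - t) * a (t, ξ)) ^ 2 := lintegral_mono hpl
    _ = ∫⁻ ξ, ∫⁻ s, (∫⁻ t, heatMultiplier ‖ξ‖ (s - t) * a (t, ξ)) ^ 2 :=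
        lintegral_lintegral_swap hm2.aemeasurable
    _ ≤ ∫⁻ ξ, 4 * ∫⁻ t, a (t, ξ) ^ 2 := by
        refine lintegral_mono fun ξ => ?_
        refine (lintegral_convolution_sq_le (k := heatMultiplier ‖ξ‖) (f := fun t => a (t, ξ))
          (measurable_heatMultiplier.comp (measurable_const.prodMk measurable_id))
          (ham.comp (measurable_id.prodMk measurable_const))).trans ?_
        gcongr
        -- Young's inequality brings in the square of the `L¹` norm of the multiplier.
        calc _ ≤ (2 : ℝ≥0∞) ^ 2 := by
              gcongr
              exact lintegral_heatMultiplier_le _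
          _ = 4 := by norm_num
    _ = 4 * ∫⁻ t, ∫⁻ ξ, a (t, ξ) ^ 2 := by
        rw [lintegral_const_mul _ (ham.pow_const 2).lintegral_prod_left',
          lintegral_lintegral_swap]
        exact ((ham.comp measurable_swap).pow_const 2).aemeasurable
    _ = 4 * ∫⁻ t, ∫⁻ x, ‖φ (t, x)‖ₑ ^ 2 := by
        congr 1
        refine lintegral_congr fun t => ?_
        have hc1 : Continuous fun x => (φ (t, x) : ℂ) :=
          Complex.continuous_ofReal.comp (contDiff_slice hφ t).continuous
        have hc2 : HasCompactSupport fun x => (φ (t, x) : ℂ) :=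
          (hasCompactSupport_slice hs t).comp_left (g := ((↑) : ℝ → ℂ)) Complex.ofReal_zero
        have h1 := lintegral_enorm_fourier_sq (hc1.integrable_of_hasCompactSupport hc2)
          (hc1.memLp_of_hasCompactSupport hc2)
        have h2 : ∀ x, ‖(φ (t, x) : ℂ)‖ₑ = ‖φ (t, x)‖ₑ := fun y => by
          rw [← ofReal_norm, ← ofReal_norm, Complex.norm_real]
        simp only [h2] at h1
        exact h1
    _ = _ := by
        rw [Measure.volume_eq_prod,
          lintegral_prod _ (hφ.continuous.measurable.enorm.pow_const 2).aemeasurable]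

/-! ### Decay of potentials away from the support -/

theorem parabolicDist_nonneg {d : ℕ} (t : ℝ) (x : Rd d) (z : ℝ × Rd d) :
    0 ≤ parabolicDist t x z := by
  unfold parabolicDist
  positivity

/-- Points outside a doubled cylinder are far from all points of the cylinder. -/
theorem parabolicDist_le_of_notMem {d : ℕ} {t : ℝ} {x : Rd d} {r : ℝ} (hr : 0 < r)
    {z w : ℝ × Rd d} (hz : z ∈ parabolicCylinder t x r) (hzw : z.1 < w.1)
    (hw : w ∉ parabolicCylinder t x (2 * r)) :
    parabolicDist t x w ≤ 3 * (√(w.1 - z.1) + ‖z.2 - w.2‖) := by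
  obtain ⟨⟨hz1, hz2⟩, hz3⟩ := hz
  rw [Metric.mem_ball, dist_eq_norm] at hz3
  have h1 : ‖w.2 - x‖ ≤ ‖z.2 - w.2‖ + r := by
    have := norm_add_le (w.2 - z.2) (z.2 - x)
    rw [sub_add_sub_cancel, norm_sub_rev w.2 z.2] at this
    linarith
  have hτ := Real.sq_sqrt (sub_nonneg.2 hzw.le)
  have hτ0 := Real.sqrt_nonneg (w.1 - z.1)
  have h2 : √(w.1 - t) ≤ √(w.1 - z.1) + r := by
    rw [Real.sqrt_le_left (by positivity)]
    nlinarith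
  have hD := norm_nonneg (z.2 - w.2)
  unfold parabolicDist
  rw [parabolicCylinder, mem_prod, not_and_or] at hw
  -- In both cases `r ≤ √(w.1 - z.1) + ‖z.2 - w.2‖`: leaving the doubled cylinder in time gives `r ≤
  -- √(w.1 - z.1)`, and leaving it in space gives `r ≤ ‖z.2 - w.2‖`. The triangle inequality loses
  -- `2r` in total, hence the factor `3`.
  rcases hw with hw | hw
  · have h3 : t + (2 * r) ^ 2 ≤ w.1 := by
      by_contra hc
      exact hw ⟨hz1.trans hzw, not_le.1 hc⟩
    have := Real.le_sqrt_of_sq_le (x := 2 * r) (y := w.1 - t) (by linarith)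
    linarith
  · rw [Metric.mem_ball, dist_eq_norm, not_lt] at hw
    linarith

theorem inv_pow_le_of_notMem {d : ℕ} {t : ℝ} {x : Rd d} {r : ℝ} (hr : 0 < r)
    {z w : ℝ × Rd d} (hz : z ∈ parabolicCylinder t x r) (hzw : z.1 < w.1)
    (hw : w ∉ parabolicCylinder t x (2 * r)) (n : ℕ) :
    ((√(w.1 - z.1) + ‖z.2 - w.2‖) ^ n)⁻¹ ≤ 3 ^ n * (parabolicDist t x w ^ n)⁻¹ := by
  have h1 := parabolicDist_le_of_notMem hr hz hzw hw
  have h2 : 0 < parabolicDist t x w := by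
    have := le_parabolicDist_of_notMem (hz.1.1.trans hzw) hw
    linarith
  have h3 : parabolicDist t x w ^ n ≤ 3 ^ n * (√(w.1 - z.1) + ‖z.2 - w.2‖) ^ n := by
    rw [← mul_pow]
    gcongr
  have h4 : 0 < √(w.1 - z.1) + ‖z.2 - w.2‖ := by linarith
  rw [← div_eq_mul_inv, le_div_iff₀ (by positivity), inv_mul_le_iff₀ (by positivity)]
  linarith

/-- All points of the support are at a distance from `w` comparable to that of the base point, so
the kernel bound comes out of the integral. No derivative is involved; the estimate serves to
justify Fubini. -/
theorem lintegral_spaceTimeKernel_far_le (d : ℕ) : ∃ C : ℝ, 0 ≤ C ∧ ∀ (t : ℝ) (x : Rd d) (r : ℝ),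
    0 < r → ∀ Φ : ℝ × Rd d → ℝ, Measurable Φ → Function.support Φ ⊆ parabolicCylinder t x r →
      ∀ w : ℝ × Rd d, w ∉ parabolicCylinder t x (2 * r) →
        ∫⁻ z, ENNReal.ofReal (spaceTimeKernel d z w) * ‖Φ z‖ₑ ≤
          ENNReal.ofReal (C * (w.1 - t) * (parabolicDist t x w ^ (d + 2))⁻¹) * ∫⁻ z, ‖Φ z‖ₑ := by
  obtain ⟨C, hC, h⟩ := exists_heatKernel_le d
  refine ⟨C * 3 ^ (d + 2), by positivity, fun t x r hr Φ hΦ hsupp w hw => ?_⟩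
  rw [← lintegral_const_mul _ hΦ.enorm]
  refine lintegral_mono fun z => ?_
  by_cases hz : Φ z = 0
  · simp [hz]
  have hz' := hsupp hz
  by_cases hzw : z.1 < w.1
  swap
  · simp [spaceTimeKernel, hzw]
  gcongr
  simp only [spaceTimeKernel, hzw, if_true]
  have h0 := parabolicDist_nonneg t x w
  have h1 : 0 ≤ w.1 - z.1 := by linarith
  have h2 : w.1 - z.1 ≤ w.1 - t := by linarith [hz'.1.1]
  calc _ ≤ C * (w.1 - z.1) * ((√(w.1 - z.1) + ‖z.2 - w.2‖) ^ (d + 2))⁻¹ :=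
        h _ (sub_pos.2 hzw) _ _
    _ ≤ C * (w.1 - t) * (3 ^ (d + 2) * (parabolicDist t x w ^ (d + 2))⁻¹) :=
        mul_le_mul (mul_le_mul_of_nonneg_left h2 hC) (inv_pow_le_of_notMem hr hz' hzw hw _)
          (by positivity) (mul_nonneg hC (h1.trans h2))
    _ = _ := by ring

/-- Causality: the kernel only transports mass forward in time. This is why cylinders starting at
time `t` suffice for the decomposition. -/
theorem heatPotential_eq_zero_of_le {d : ℕ} {t : ℝ} {Φ : ℝ × Rd d → ℝ}
    (h : ∀ z, Φ z ≠ 0 → t < z.1) {w : ℝ × Rd d} (hw : w.1 ≤ t) : heatPotential Φ w = 0 := by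
  refine integral_eq_zero_of_ae (ae_of_all _ fun z => ?_)
  by_cases hz : Φ z = 0
  · simp [hz]
  · have := h z hz
    simp [spaceTimeKernel, not_lt.2 (hw.trans this.le)]

/-- Moving two spatial derivatives from a test function to the heat kernel. -/
theorem integral_heatKernel_mul_spatialPartial {d : ℕ} (i j : Fin d) {φ : ℝ × Rd d → ℝ}
    (hφ : ContDiff ℝ ∞ φ) (hs : HasCompactSupport φ) (t τ : ℝ) (y : Rd d) :
    ∫ x, heatKernel d τ x y * spatialPartial i (spatialPartial j φ) (t, x) =
      ∫ x, heatKernelHess d i j τ x y * φ (t, x) := by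
  have hjs := hasCompactSupport_spatialPartial j hφ hs
  have hjc := contDiff_spatialPartial j hφ
  have hint : ∀ {k : Rd d → ℝ} {ψ : ℝ × Rd d → ℝ}, Continuous k → ContDiff ℝ ∞ ψ →
      HasCompactSupport ψ → Integrable fun x => ContinuousLinearMap.mul ℝ ℝ (k x) (ψ (t, x)) :=
    fun hk hψ hψs => (hk.mul (contDiff_slice hψ t).continuous).integrable_of_hasCompactSupport
      (hasCompactSupport_slice hψs t).mul_left
  have h1 := integral_bilinear_hasLineDerivAt_right_eq_neg_left_of_integrable (μ := volume)
    (f := fun x => heatKernel d τ x y) (f' := fun x => heatKernelGrad d i τ x y)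
    (g := fun x => spatialPartial j φ (t, x))
    (g' := fun x => spatialPartial i (spatialPartial j φ) (t, x))
    (v := EuclideanSpace.single i 1) (B := ContinuousLinearMap.mul ℝ ℝ)
    (hint (continuous_heatKernelGrad i τ y) hjc hjs)
    (hint (continuous_heatKernel τ y) (contDiff_spatialPartial i hjc)
      (hasCompactSupport_spatialPartial i hjc hjs))
    (hint (continuous_heatKernel τ y) hjc hjs)
    (fun x _ => hasLineDerivAt_heatKernel i τ x y) (fun x _ => hasLineDerivAt_slice i hjc t x)
  have h2 := integral_bilinear_hasLineDerivAt_right_eq_neg_left_of_integrable (μ := volume)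
    (f := fun x => heatKernelGrad d i τ x y) (f' := fun x => heatKernelHess d i j τ x y)
    (g := fun x => φ (t, x)) (g' := fun x => spatialPartial j φ (t, x))
    (v := EuclideanSpace.single j 1) (B := ContinuousLinearMap.mul ℝ ℝ)
    (hint (continuous_heatKernelHess i j τ y) hφ hs)
    (hint (continuous_heatKernelGrad i τ y) hjc hjs)
    (hint (continuous_heatKernelGrad i τ y) hφ hs)
    (fun x _ => hasLineDerivAt_heatKernelGrad i j τ x y) (fun x _ => hasLineDerivAt_slice j hφ t x)
  simp only [ContinuousLinearMap.mul_apply'] at h1 h2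
  rw [h1, h2, neg_neg]

theorem support_spatialPartial_subset {d : ℕ} (i j : Fin d) {φ : ℝ × Rd d → ℝ}
    (hφ : ContDiff ℝ ∞ φ) :
    Function.support (spatialPartial i (spatialPartial j φ)) ⊆ tsupport φ :=
  (subset_tsupport _).trans ((tsupport_spatialPartial_subset i (contDiff_spatialPartial j hφ)).trans
    (tsupport_spatialPartial_subset j hφ))

/-- Pointwise decay of second derivatives of heat potentials away from the support. -/
theorem exists_enorm_heatPotential_far_le (d : ℕ) : ∃ C : ℝ, 0 ≤ C ∧ ∀ (i j : Fin d) (t : ℝ)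
    (x : Rd d) (r : ℝ), 0 < r → ∀ φ : ℝ × Rd d → ℝ, ContDiff ℝ ∞ φ → HasCompactSupport φ →
      tsupport φ ⊆ parabolicCylinder t x r →
      ∀ w : ℝ × Rd d, w ∉ parabolicCylinder t x (2 * r) →
        ‖heatPotential (spatialPartial i (spatialPartial j φ)) w‖ₑ ≤
          ENNReal.ofReal (C * (parabolicDist t x w ^ (d + 2))⁻¹) * ∫⁻ z, ‖φ z‖ₑ := by
  obtain ⟨C, hC, h⟩ := exists_abs_heatKernelHess_le d
  refine ⟨C * 3 ^ (d + 2), by positivity, fun i j t x r hr φ hφ hs hsupp w hw => ?_⟩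
  have hjs := hasCompactSupport_spatialPartial j hφ hs
  have hjc := contDiff_spatialPartial j hφ
  have hi := integrable_spaceTimeKernel_mul (contDiff_spatialPartial i hjc).continuous
    (hasCompactSupport_spatialPartial i hjc hjs) w
  have hm := hφ.continuous.measurable
  unfold heatPotential
  rw [Measure.volume_eq_prod] at hi ⊢
  rw [integral_prod _ hi, lintegral_prod _ hm.enorm.aemeasurable,
    ← lintegral_const_mul _ hm.enorm.lintegral_prod_right']
  refine (enorm_integral_le_lintegral_enorm _).trans (lintegral_mono fun a => ?_)
  by_cases haw : a < w.1
  swap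
  · simp [spaceTimeKernel, haw]
  simp only [spaceTimeKernel, haw, if_true]
  have hma : Measurable fun y => ‖φ (a, y)‖ₑ :=
    (hm.comp (measurable_const.prodMk measurable_id)).enorm
  -- At a fixed time `a < w.1` the kernel is smooth in space, so the two integrations by parts need
  -- no treatment of its singularity.
  rw [integral_heatKernel_mul_spatialPartial i j hφ hs, ← lintegral_const_mul _ hma]
  refine (enorm_integral_le_lintegral_enorm _).trans (lintegral_mono fun y => ?_)
  rw [enorm_mul]
  by_cases hz : φ (a, y) = 0
  · simp [hz]
  have hz' := hsupp (subset_tsupport _ hz)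
  gcongr
  rw [← ofReal_norm]
  refine ENNReal.ofReal_le_ofReal ?_
  calc _ ≤ C * ((√(w.1 - a) + ‖y - w.2‖) ^ (d + 2))⁻¹ := h i j _ (sub_pos.2 haw) _ _
    _ ≤ C * (3 ^ (d + 2) * (parabolicDist t x w ^ (d + 2))⁻¹) := by
        gcongr
        exact inv_pow_le_of_notMem hr hz' haw hw _
    _ = _ := by ring

theorem lintegral_le_near_add_far {d : ℕ} {f : ℝ × Rd d → ℝ≥0∞} {t : ℝ}
    (h : ∀ w : ℝ × Rd d, w.1 ≤ t → f w = 0) (x : Rd d) (r : ℝ) :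
    ∫⁻ w, f w ≤ (∫⁻ w in parabolicCylinder t x r, f w) +
      ∫⁻ w in {w : ℝ × Rd d | t < w.1} \ parabolicCylinder t x r, f w := by
  refine le_trans ?_ (lintegral_union_le _ _ _)
  rw [union_sdiff_self, ← lintegral_indicator
    ((measurableSet_parabolicCylinder t x r).union (measurableSet_lt measurable_const measurable_fst))]
  refine lintegral_mono fun w => ?_
  by_cases hw : t < w.1
  · rw [indicator_of_mem (show w ∈ parabolicCylinder t x r ∪ {a : ℝ × Rd d | t < a.1} from Or.inr hw)]
  · rw [h w (not_lt.1 hw)]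
    exact zero_le

/-- Cauchy-Schwarz on the cylinder: the second factor is the square root of its volume. -/
theorem lintegral_enorm_le_of_support_subset {d : ℕ} {φ : ℝ × Rd d → ℝ} (hφ : Measurable φ)
    {t : ℝ} {x : Rd d} {r : ℝ} (hr : 0 < r) (hsupp : Function.support φ ⊆ parabolicCylinder t x r) :
    ∫⁻ z, ‖φ z‖ₑ ≤ (∫⁻ z, ‖φ z‖ₑ ^ 2) ^ (1 / 2 : ℝ) *
      ENNReal.ofReal (√(unitBallVolume d) * r ^ (((d : ℝ) + 2) / 2)) := by
  have h1 := setLIntegral_mul_le_sqrt (μ := volume) (parabolicCylinder t x r) hφ.enorm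
    (measurable_const (a := (1 : ℝ≥0∞)))
  simp only [mul_one, one_pow, lintegral_const, one_mul, Measure.restrict_apply_univ] at h1
  rw [← lintegral_indicator (measurableSet_parabolicCylinder t x r), indicator_eq_self.2] at h1
  swap
  · intro z hz
    exact hsupp fun h0 => hz (by simp [h0])
  refine h1.trans (mul_le_mul' ?_ (le_of_eq ?_))
  · exact ENNReal.rpow_le_rpow (setLIntegral_le_lintegral _ _) (by norm_num)
  · have hv := (unitBallVolume_pos d).le
    rw [volume_parabolicCylinder t x hr, ENNReal.ofReal_rpow_of_nonneg (by positivity)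
      (by norm_num), ← Real.sqrt_eq_rpow, Real.sqrt_mul hv, Real.sqrt_eq_rpow (r ^ (d + 2)),
      ← Real.rpow_natCast, ← Real.rpow_mul hr.le]
    congr 3
    push_cast
    ring

/-! ### The duality estimate and the justification of Fubini -/

/-- The parabolic Morrey-space duality estimate for second derivatives of heat potentials. -/
theorem exists_lintegral_mul_heatPotential_le {d : ℕ} {p M : ℝ} (hM : 0 ≤ M) (hp : p < d + 2)
    {N : ℝ × Rd d → ℝ≥0∞} (hN : Measurable N) (h : GrowthBound p M fun z => N z ^ 2) :
    ∃ C : ℝ, 0 ≤ C ∧ ∀ (i j : Fin d) (t : ℝ), 0 ≤ t → ∀ (x : Rd d) (r : ℝ), 0 < r →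
      ∀ φ : ℝ × Rd d → ℝ, ContDiff ℝ ∞ φ → HasCompactSupport φ →
        tsupport φ ⊆ parabolicCylinder t x r →
        ∫⁻ w, N w * ‖heatPotential (spatialPartial i (spatialPartial j φ)) w‖ₑ ≤
          ENNReal.ofReal (C * r ^ (p / 2)) * (∫⁻ z, ‖φ z‖ₑ ^ 2) ^ (1 / 2 : ℝ) := by
  obtain ⟨C₁, hC₁, h₁⟩ := exists_enorm_heatPotential_far_le d
  obtain ⟨C₂, hC₂, h₂⟩ := exists_lintegral_far_le hM hp hN h
  set β : ℝ := (p + d + 2) / 2 - (d + 2) with hβ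
  set V := √(unitBallVolume d)
  have hV : 0 ≤ V := Real.sqrt_nonneg _
  refine ⟨√M * 2 ^ (p / 2) * 2 + C₁ * V * (C₂ * 2 ^ β), by positivity,
    fun i j t ht x r hr φ hφ hs hsupp => ?_⟩
  set g := heatPotential (spatialPartial i (spatialPartial j φ)) with hg
  set A := ∫⁻ z, ‖φ z‖ₑ ^ 2 with hA
  have hgm : Measurable g := measurable_heatPotential
    (contDiff_spatialPartial i (contDiff_spatialPartial j hφ)).continuous.measurable
  have hzero : ∀ w : ℝ × Rd d, w.1 ≤ t → N w * ‖g w‖ₑ = 0 := by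
    intro w hw
    have : g w = 0 := heatPotential_eq_zero_of_le
      (fun z hz => (hsupp (support_spatialPartial_subset i j hφ hz)).1.1) hw
    simp [this]
  refine (lintegral_le_near_add_far hzero x (2 * r)).trans ?_
  -- Near part: growth of `N²` on the doubled cylinder times the `L²` bound; the factor `2` is the
  -- square root of the constant `4` there.
  have hnear : ∫⁻ w in parabolicCylinder t x (2 * r), N w * ‖g w‖ₑ ≤
      ENNReal.ofReal (√M * 2 ^ (p / 2) * 2 * r ^ (p / 2)) * A ^ (1 / 2 : ℝ) := by
    refine (setLIntegral_mul_le_sqrt _ hN hgm.enorm).trans ?_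
    calc _ ≤ ENNReal.ofReal (M * (2 * r) ^ p) ^ (1 / 2 : ℝ) * (4 * A) ^ (1 / 2 : ℝ) := by
          gcongr
          · exact h t ht x (2 * r) (by positivity)
          · exact (setLIntegral_le_lintegral _ _).trans
              (lintegral_heatPotential_spatialPartial_sq_le i j hφ hs)
      _ = _ := by
          have e4 : (4 : ℝ≥0∞) ^ (1 / 2 : ℝ) = ENNReal.ofReal 2 := by
            have : (4 : ℝ≥0∞) = (2 : ℝ≥0∞) ^ (2 : ℝ) := by norm_num
            rw [this, ← ENNReal.rpow_mul]
            norm_num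
          rw [ENNReal.mul_rpow_of_nonneg _ _ (by norm_num), e4, ← mul_assoc,
            ENNReal.ofReal_rpow_of_nonneg (by positivity) (by norm_num),
            ← ENNReal.ofReal_mul (by positivity)]
          congr 2
          rw [Real.mul_rpow hM (by positivity), ← Real.rpow_mul (by positivity),
            Real.mul_rpow (by norm_num) hr.le, ← Real.sqrt_eq_rpow, mul_one_div]
          ring
  -- Far part: the weighted integral of `N` is of order `r^β`, and the `L¹` norm of `φ` costs
  -- `r^((d+2)/2)` times its `L²` norm. The exponents add up to `p/2`, as in the near part.
  have hfar : ∫⁻ w in {w : ℝ × Rd d | t < w.1} \ parabolicCylinder t x (2 * r), N w * ‖g w‖ₑ ≤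
      ENNReal.ofReal (C₁ * V * (C₂ * 2 ^ β) * r ^ (p / 2)) * A ^ (1 / 2 : ℝ) := by
    have hI := lintegral_enorm_le_of_support_subset hφ.continuous.measurable hr
      ((subset_tsupport _).trans hsupp)
    have hms : MeasurableSet ({w : ℝ × Rd d | t < w.1} \ parabolicCylinder t x (2 * r)) :=
      (measurableSet_lt measurable_const measurable_fst).diff
        (measurableSet_parabolicCylinder t x (2 * r))
    have hmρ : Measurable fun w : ℝ × Rd d =>
        ENNReal.ofReal ((parabolicDist t x w ^ (d + 2))⁻¹) := by
      unfold parabolicDist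
      fun_prop
    calc _ ≤ ∫⁻ w in {w : ℝ × Rd d | t < w.1} \ parabolicCylinder t x (2 * r),
          (N w * ENNReal.ofReal ((parabolicDist t x w ^ (d + 2))⁻¹)) *
            (ENNReal.ofReal C₁ * ∫⁻ z, ‖φ z‖ₑ) := by
          refine setLIntegral_mono' hms fun w hw => ?_
          have := h₁ i j t x r hr φ hφ hs hsupp w hw.2
          rw [ENNReal.ofReal_mul hC₁] at this
          calc _ ≤ N w * (ENNReal.ofReal C₁ * ENNReal.ofReal ((parabolicDist t x w ^ (d + 2))⁻¹) *
                ∫⁻ z, ‖φ z‖ₑ) := by gcongr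
            _ = _ := by ring
      _ = (∫⁻ w in {w : ℝ × Rd d | t < w.1} \ parabolicCylinder t x (2 * r),
          N w * ENNReal.ofReal ((parabolicDist t x w ^ (d + 2))⁻¹)) *
            (ENNReal.ofReal C₁ * ∫⁻ z, ‖φ z‖ₑ) := lintegral_mul_const _ (hN.mul hmρ)
      _ ≤ ENNReal.ofReal (C₂ * (2 * r) ^ β) * (ENNReal.ofReal C₁ * (A ^ (1 / 2 : ℝ) *
          ENNReal.ofReal (V * r ^ (((d : ℝ) + 2) / 2)))) := by
          gcongr
          exact h₂ t ht x (2 * r) (by positivity)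
      _ = ENNReal.ofReal (C₂ * (2 * r) ^ β * (C₁ * (V * r ^ (((d : ℝ) + 2) / 2)))) *
          A ^ (1 / 2 : ℝ) := by
          rw [ENNReal.ofReal_mul (by positivity : 0 ≤ C₂ * (2 * r) ^ β), ENNReal.ofReal_mul hC₁]
          ring
      _ = _ := by
          congr 2
          have : r ^ (p / 2) = r ^ β * r ^ (((d : ℝ) + 2) / 2) := by
            rw [← Real.rpow_add hr, hβ]
            congr 1
            ring
          rw [Real.mul_rpow (by norm_num) hr.le, this]
          ring
  calc _ ≤ _ := add_le_add hnear hfar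
    _ = _ := by
        rw [← add_mul, ← ENNReal.ofReal_add (by positivity) (by positivity), ← add_mul]

/-- Integrability needed to exchange the mild formulation with a test function. -/
theorem lintegral_mul_lintegral_spaceTimeKernel_lt_top {d : ℕ} {p M T : ℝ} (hM : 0 ≤ M)
    (hT : 0 < T) (hp : p < d + 2) {N : ℝ × Rd d → ℝ≥0∞} (hN : Measurable N)
    (h : GrowthBound p M fun z => N z ^ 2) (hN0 : ∀ w, w.1 ∉ Ioo 0 T → N w = 0)
    {Φ : ℝ × Rd d → ℝ} (hc : Continuous Φ) (hs : HasCompactSupport Φ)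
    (hsupp : Function.support Φ ⊆ Ioo 0 T ×ˢ univ) :
    ∫⁻ w, N w * ∫⁻ z, ENNReal.ofReal (spaceTimeKernel d z w) * ‖Φ z‖ₑ < ⊤ := by
  obtain ⟨C₁, hC₁, h₁⟩ := lintegral_spaceTimeKernel_far_le d
  obtain ⟨C₂, hC₂, h₂⟩ := exists_lintegral_far_le hM hp hN h
  obtain ⟨a, b, B, hB, hbd⟩ := exists_enorm_le_indicator hc hs
  obtain ⟨R, hR⟩ := hs.isBounded.subset_closedBall (0 : ℝ × Rd d)
  -- Large enough for one cylinder based at the origin to contain the support: `|R| < r` covers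
  -- space, and `T ≤ r ≤ r²` covers time.
  set r : ℝ := |R| + 1 + T with hr
  have hr1 : 1 ≤ r := by rw [hr]; linarith [abs_nonneg R]
  have hr0 : 0 < r := by linarith
  have hΦr : Function.support Φ ⊆ parabolicCylinder 0 0 r := by
    intro z hz
    have h3 := hR (subset_tsupport _ hz)
    rw [mem_closedBall_zero_iff] at h3
    have h4 := (norm_snd_le z).trans h3
    have h5 := (hsupp hz).1
    refine ⟨⟨h5.1, ?_⟩, ?_⟩
    · have h6 : T ≤ r := by rw [hr]; linarith [abs_nonneg R]
      have h7 := h5.2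
      nlinarith
    · rw [mem_ball_zero_iff, hr]
      linarith [le_abs_self R]
  have hI : ∫⁻ z, ‖Φ z‖ₑ < ⊤ := (hc.integrable_of_hasCompactSupport hs (μ := volume)).2
  have hzero : ∀ w : ℝ × Rd d, w.1 ≤ 0 →
      N w * ∫⁻ z, ENNReal.ofReal (spaceTimeKernel d z w) * ‖Φ z‖ₑ = 0 := fun w hw => by
    rw [hN0 w fun hw' => hw'.1.not_ge hw, zero_mul]
  -- Near the support the inner integral is bounded and `N` is integrable on the cylinder; far away
  -- the kernel decay, with `w.1 - t ≤ T`, reduces to the far-field sum.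
  refine (lintegral_le_near_add_far hzero 0 (2 * r)).trans_lt (ENNReal.add_lt_top.2 ⟨?_, ?_⟩)
  · calc _ ≤ ∫⁻ w in parabolicCylinder 0 0 (2 * r), N w * (ENNReal.ofReal B * volume (Icc a b)) := by
          gcongr
          exact lintegral_spaceTimeKernel_mul_le measurableSet_Icc hbd _
      _ = (∫⁻ w in parabolicCylinder 0 0 (2 * r), N w) * (ENNReal.ofReal B * volume (Icc a b)) :=
          lintegral_mul_const _ hN
      _ < ⊤ := ENNReal.mul_lt_top
          ((GrowthBound.lintegral_le hM hN h le_rfl 0 (by positivity)).trans_lt ENNReal.ofReal_lt_top)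
          (ENNReal.mul_lt_top ENNReal.ofReal_lt_top measure_Icc_lt_top)
  · have hms : MeasurableSet ({w : ℝ × Rd d | 0 < w.1} \ parabolicCylinder 0 0 (2 * r)) :=
      (measurableSet_lt measurable_const measurable_fst).diff
        (measurableSet_parabolicCylinder 0 0 (2 * r))
    have hmρ : Measurable fun w : ℝ × Rd d =>
        ENNReal.ofReal ((parabolicDist 0 0 w ^ (d + 2))⁻¹) := by
      unfold parabolicDist
      fun_prop
    calc _ ≤ ∫⁻ w in {w : ℝ × Rd d | 0 < w.1} \ parabolicCylinder 0 0 (2 * r),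
          (N w * ENNReal.ofReal ((parabolicDist 0 0 w ^ (d + 2))⁻¹)) *
            (ENNReal.ofReal (C₁ * T) * ∫⁻ z, ‖Φ z‖ₑ) := by
          refine setLIntegral_mono' hms fun w hw => ?_
          by_cases hwT : w.1 ∈ Ioo 0 T
          swap
          · simp [hN0 w hwT]
          have h3 := h₁ 0 0 r hr0 Φ hc.measurable hΦr w hw.2
          have h4 := parabolicDist_nonneg 0 0 w
          calc _ ≤ N w * (ENNReal.ofReal (C₁ * T * (parabolicDist 0 0 w ^ (d + 2))⁻¹) *
                ∫⁻ z, ‖Φ z‖ₑ) := by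
                gcongr
                refine h3.trans ?_
                gcongr
                linarith [hwT.2]
            _ = _ := by
                rw [ENNReal.ofReal_mul (by positivity)]
                ring
      _ = (∫⁻ w in {w : ℝ × Rd d | 0 < w.1} \ parabolicCylinder 0 0 (2 * r),
          N w * ENNReal.ofReal ((parabolicDist 0 0 w ^ (d + 2))⁻¹)) *
            (ENNReal.ofReal (C₁ * T) * ∫⁻ z, ‖Φ z‖ₑ) := lintegral_mul_const _ (hN.mul hmρ)
      _ < ⊤ := ENNReal.mul_lt_top
          ((h₂ 0 le_rfl 0 (2 * r) (by positivity)).trans_lt ENNReal.ofReal_lt_top)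
          (ENNReal.mul_lt_top ENNReal.ofReal_lt_top hI)

/-! ### Representation of bounded functionals on test functions -/

section Representation

/-- A linear functional bounded by the norm of a linear map into a Hilbert space is an inner
product against the values of this map. -/
theorem exists_inner_representation {A H : Type*} [AddCommGroup A] [Module ℝ A]
    [NormedAddCommGroup H] [InnerProductSpace ℝ H] [CompleteSpace H] (ι : A →ₗ[ℝ] H)
    (L : A →ₗ[ℝ] ℝ) {K : ℝ} (hK : 0 ≤ K) (hbound : ∀ φ, ‖L φ‖ ≤ K * ‖ι φ‖) :
    ∃ W : H, ‖W‖ ≤ K ∧ ∀ φ, L φ = inner ℝ W (ι φ) := by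
  -- Since `ι` need not be injective, `L` is transported to the range through a linear section, then
  -- extended with the same norm by Hahn-Banach and represented by Riesz.
  obtain ⟨s, hs⟩ := ι.rangeRestrict.exists_rightInverse_of_surjective ι.range_rangeRestrict
  have hsv : ∀ v : ι.range, ι (s v) = v := fun v =>
    congrArg Subtype.val (LinearMap.congr_fun hs v)
  let ℓ : StrongDual ℝ ι.range := (L ∘ₗ s).mkContinuous K fun v => by
    have := hbound (s v)
    rw [hsv] at this
    exact this
  obtain ⟨ℓ', hℓ', hℓn⟩ := exists_extension_norm_eq ι.range ℓ
  refine ⟨(InnerProductSpace.toDual ℝ H).symm ℓ', ?_, fun φ => ?_⟩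
  · rw [LinearIsometryEquiv.norm_map, hℓn]
    exact LinearMap.mkContinuous_norm_le _ hK _
  · rw [InnerProductSpace.toDual_symm_apply]
    have h1 := hℓ' ⟨ι φ, LinearMap.mem_range_self ι φ⟩
    -- The difference `s (ι φ) - φ` lies in the kernel of `ι`, where the bound forces `L` to vanish;
    -- the choice of section is therefore immaterial.
    have h2 := hbound (s ⟨ι φ, LinearMap.mem_range_self ι φ⟩ - φ)
    rw [map_sub ι, hsv, sub_self, norm_zero, mul_zero, norm_le_zero_iff, map_sub, sub_eq_zero] at h2
    rw [← h2]
    exact h1.symm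

variable {E : Type*} [NormedAddCommGroup E] [NormedSpace ℝ E]
  [MeasurableSpace E] [BorelSpace E] {μ : Measure E} [IsFiniteMeasureOnCompacts μ]

/-- The space `C_c^∞(V)`. -/
def testFunctions (V : Set E) : Submodule ℝ (E → ℝ) where
  carrier := {φ | ContDiff ℝ ∞ φ ∧ HasCompactSupport φ ∧ tsupport φ ⊆ V}
  add_mem' := fun {a b} ha hb => ⟨ha.1.add hb.1, ha.2.1.add hb.2.1,
    (tsupport_add a b).trans (union_subset ha.2.2 hb.2.2)⟩
  zero_mem' := ⟨contDiff_const, HasCompactSupport.zero, by simp [tsupport]⟩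
  smul_mem' := fun c a ha => ⟨contDiff_const.smul ha.1, ha.2.1.smul_left (f := fun _ => c),
    (tsupport_smul_subset_right (fun _ => c) a).trans ha.2.2⟩

/-- A linear functional on `C_c^∞(V)` bounded in `L²` is represented by an `L²` function. -/
theorem exists_L2_representation {V : Set E} (L : testFunctions V →ₗ[ℝ] ℝ) {K : ℝ} (hK : 0 ≤ K)
    (hL : ∀ φ, ENNReal.ofReal |L φ| ≤
      ENNReal.ofReal K * (∫⁻ x, ‖(φ : E → ℝ) x‖ₑ ^ 2 ∂μ) ^ (1 / 2 : ℝ)) :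
    ∃ w : E → ℝ, Measurable w ∧ ∫⁻ x, ‖w x‖ₑ ^ 2 ∂μ ≤ ENNReal.ofReal (K ^ 2) ∧
      ∀ φ, L φ = ∫ x, w x * (φ : E → ℝ) x ∂μ := by
  have hmem : ∀ φ : testFunctions V, MemLp (φ : E → ℝ) 2 μ := fun φ =>
    φ.2.1.continuous.memLp_of_hasCompactSupport φ.2.2.1
  have hsq : ∀ f : E → ℝ, eLpNorm f 2 μ = (∫⁻ x, ‖f x‖ₑ ^ 2 ∂μ) ^ (1 / 2 : ℝ) := fun f => by
    rw [eLpNorm_eq_lintegral_rpow_enorm_toReal (by norm_num) (by norm_num)]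
    simp
  let ι : testFunctions V →ₗ[ℝ] Lp ℝ 2 μ :=
    { toFun := fun φ => (hmem φ).toLp
      map_add' := fun φ ψ => MemLp.toLp_add (hmem φ) (hmem ψ)
      map_smul' := fun c φ => MemLp.toLp_const_smul c (hmem φ) }
  have hbound : ∀ φ, ‖L φ‖ ≤ K * ‖ι φ‖ := by
    intro φ
    have h1 := hL φ
    rw [← hsq, ← Lp.enorm_toLp (hf := hmem φ), ← ofReal_norm, ← ENNReal.ofReal_mul hK] at h1
    exact (ENNReal.ofReal_le_ofReal_iff (by positivity)).1 h1
  obtain ⟨W, hWn, hWL⟩ := exists_inner_representation ι L hK hbound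
  refine ⟨W, (Lp.stronglyMeasurable W).measurable, ?_, fun φ => ?_⟩
  · have h2 := hsq W
    rw [← Lp.enorm_def, ← ofReal_norm] at h2
    have h3 : ∫⁻ x, ‖W x‖ₑ ^ 2 ∂μ = ENNReal.ofReal ‖W‖ ^ 2 := by
      rw [h2, ← ENNReal.rpow_two, ← ENNReal.rpow_mul]
      norm_num
    rw [h3, ← ENNReal.ofReal_pow (norm_nonneg _)]
    gcongr
  · rw [hWL, L2.inner_def]
    refine integral_congr_ae ?_
    filter_upwards [(hmem φ).coeFn_toLp] with x hx
    simp only [ι, LinearMap.coe_mk, AddHom.coe_mk]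
    rw [hx]
    simp [mul_comm]

/-- An `L²` function representing a functional on `C_c^∞(V)` is unique almost everywhere on `V`. -/
theorem ae_eq_of_forall_testFunctions [FiniteDimensional ℝ E] {V : Set E} (hV : IsOpen V) {w₁ w₂ : E → ℝ}
    (h₁ : MemLp w₁ 2 μ) (h₂ : MemLp w₂ 2 μ)
    (h : ∀ φ ∈ testFunctions V, ∫ x, w₁ x * φ x ∂μ = ∫ x, w₂ x * φ x ∂μ) :
    ∀ᵐ x ∂μ, x ∈ V → w₁ x = w₂ x := by
  have h3 : LocallyIntegrable (w₁ - w₂) μ := (h₁.sub h₂).locallyIntegrable (by norm_num)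
  have := hV.ae_eq_zero_of_integral_contDiff_smul_eq_zero (h3.locallyIntegrableOn V)
    fun g hg hgs hgV => ?_
  · filter_upwards [this] with x hx hxV
    exact sub_eq_zero.1 (hx hxV)
  · have h4 := h g ⟨hg, hgs, hgV⟩
    have hg2 : MemLp g 2 μ := hg.continuous.memLp_of_hasCompactSupport hgs
    have e : ∀ x, g x • (w₁ - w₂) x = w₁ x * g x - w₂ x * g x := fun x => by
      simp only [Pi.sub_apply, smul_eq_mul]
      ring
    simp_rw [e]
    exact (integral_sub (h₁.integrable_mul hg2) (h₂.integrable_mul hg2)).trans (sub_eq_zero.2 h4)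

end Representation

/-! ### Weak second derivatives of backward potentials -/

/-- The backward heat potential `∫_t^∞ P_{s-t} h(s) ds`. -/
noncomputable def backwardPotential {d : ℕ} (h : ℝ × Rd d → ℝ) (z : ℝ × Rd d) : ℝ :=
  ∫ w, spaceTimeKernel d z w * h w

section Potential

variable {d : ℕ} {p M T : ℝ} {h : ℝ × Rd d → ℝ}

/-- The source is only controlled locally in space, so absolute convergence has to come from kernel
decay: Tonelli with the test variable first reduces it to
`lintegral_mul_lintegral_spaceTimeKernel_lt_top`. -/
theorem integrable_backwardPotential_prod (hM : 0 ≤ M)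
    (hT : 0 < T) (hp : p < d + 2) (hm : Measurable h)
    (hg : GrowthBound p M fun z => ‖h z‖ₑ ^ 2) (h0 : ∀ w, w.1 ∉ Ioo 0 T → h w = 0)
    {Φ : ℝ × Rd d → ℝ} (hc : Continuous Φ) (hs : HasCompactSupport Φ)
    (hsupp : Function.support Φ ⊆ Ioo 0 T ×ˢ univ) :
    Integrable (fun q : (ℝ × Rd d) × (ℝ × Rd d) => spaceTimeKernel d q.1 q.2 * h q.2 * Φ q.1)
      (volume.prod volume) := by
  have hmq : Measurable fun q : (ℝ × Rd d) × (ℝ × Rd d) =>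
      spaceTimeKernel d q.1 q.2 * h q.2 * Φ q.1 :=
    ((measurable_spaceTimeKernel d).mul (hm.comp measurable_snd)).mul
      (hc.measurable.comp measurable_fst)
  refine ⟨hmq.aestronglyMeasurable, ?_⟩
  rw [HasFiniteIntegral, lintegral_prod_symm' _ hmq.enorm]
  refine lt_of_eq_of_lt (lintegral_congr fun w => ?_)
    (lintegral_mul_lintegral_spaceTimeKernel_lt_top hM hT hp hm.enorm hg
      (fun w hw => by simp [h0 w hw]) hc hs hsupp)
  have hmw : Measurable fun z => ENNReal.ofReal (spaceTimeKernel d z w) * ‖Φ z‖ₑ :=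
    (measurable_ofReal_spaceTimeKernel_left w).mul hc.measurable.enorm
  rw [← lintegral_const_mul _ hmw]
  refine lintegral_congr fun z => ?_
  rw [mul_right_comm, enorm_mul, enorm_spaceTimeKernel_mul, mul_comm]

theorem integrable_backwardPotential_mul (hM : 0 ≤ M)
    (hT : 0 < T) (hp : p < d + 2) (hm : Measurable h)
    (hg : GrowthBound p M fun z => ‖h z‖ₑ ^ 2) (h0 : ∀ w, w.1 ∉ Ioo 0 T → h w = 0)
    {Φ : ℝ × Rd d → ℝ} (hc : Continuous Φ) (hs : HasCompactSupport Φ)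
    (hsupp : Function.support Φ ⊆ Ioo 0 T ×ˢ univ) :
    Integrable fun z => backwardPotential h z * Φ z := by
  have := (integrable_backwardPotential_prod hM hT hp hm hg h0 hc hs hsupp).integral_prod_left
  simpa only [integral_mul_const] using! this

/-- Backward and forward heat potentials are adjoint to each other. -/
theorem integral_backwardPotential_mul (hM : 0 ≤ M)
    (hT : 0 < T) (hp : p < d + 2) (hm : Measurable h)
    (hg : GrowthBound p M fun z => ‖h z‖ₑ ^ 2) (h0 : ∀ w, w.1 ∉ Ioo 0 T → h w = 0)
    {Φ : ℝ × Rd d → ℝ} (hc : Continuous Φ) (hs : HasCompactSupport Φ)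
    (hsupp : Function.support Φ ⊆ Ioo 0 T ×ˢ univ) :
    ∫ z, backwardPotential h z * Φ z = ∫ w, h w * heatPotential Φ w := by
  have := integral_integral_swap
    (f := fun z w : ℝ × Rd d => spaceTimeKernel d z w * h w * Φ z)
    (integrable_backwardPotential_prod hM hT hp hm hg h0 hc hs hsupp)
  simp only [integral_mul_const] at this
  refine this.trans (integral_congr_ae (ae_of_all _ fun w => ?_))
  simp only [heatPotential]
  rw [← integral_const_mul]
  congr 1
  ext z
  ring

theorem spatialPartial_add (i : Fin d) {φ ψ : ℝ × Rd d → ℝ} (hφ : ContDiff ℝ ∞ φ)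
    (hψ : ContDiff ℝ ∞ ψ) : spatialPartial i (φ + ψ) = spatialPartial i φ + spatialPartial i ψ := by
  rw [spatialPartial_eq_fderiv i hφ, spatialPartial_eq_fderiv i hψ,
    spatialPartial_eq_fderiv i (φ := φ + ψ) (hφ.add hψ)]
  ext z
  rw [fderiv_add (hφ.differentiable (by simp) z) (hψ.differentiable (by simp) z)]
  rfl

theorem spatialPartial_smul (i : Fin d) (c : ℝ) {φ : ℝ × Rd d → ℝ} (hφ : ContDiff ℝ ∞ φ) :
    spatialPartial i (c • φ) = c • spatialPartial i φ := by
  rw [spatialPartial_eq_fderiv i hφ, spatialPartial_eq_fderiv i (φ := c • φ) (hφ.const_smul c)]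
  ext z
  rw [fderiv_const_smul (hφ.differentiable (by simp) z)]
  rfl

theorem support_spatialPartial_subset_of_tsupport (i j : Fin d) {φ : ℝ × Rd d → ℝ}
    {V : Set (ℝ × Rd d)} (hφ : φ ∈ testFunctions V) :
    Function.support (spatialPartial i (spatialPartial j φ)) ⊆ V :=
  (support_spatialPartial_subset i j hφ.1).trans hφ.2.2

/-- Local representation of the weak second derivatives of a backward heat potential. -/
theorem exists_local_weakDerivative (hM : 0 ≤ M)
    (hT : 0 < T) (hp : p < d + 2) (hm : Measurable h)
    (hg : GrowthBound p M fun z => ‖h z‖ₑ ^ 2) (h0 : ∀ w, w.1 ∉ Ioo 0 T → h w = 0) (i j : Fin d) :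
    ∃ C : ℝ, 0 ≤ C ∧ ∀ t : ℝ, 0 ≤ t → ∀ (x : Rd d) (r : ℝ), 0 < r →
      ∃ v : ℝ × Rd d → ℝ, Measurable v ∧ ∫⁻ z, ‖v z‖ₑ ^ 2 ≤ ENNReal.ofReal (C * r ^ p) ∧
        ∀ φ ∈ testFunctions (parabolicCylinder t x r ∩ Ioo 0 T ×ˢ univ),
          ∫ z, backwardPotential h z * spatialPartial i (spatialPartial j φ) z =
            ∫ z, v z * φ z := by
  obtain ⟨C, hC, hest⟩ := exists_lintegral_mul_heatPotential_le hM hp hm.enorm hg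
  refine ⟨C ^ 2, by positivity, fun t ht x r hr => ?_⟩
  set V : Set (ℝ × Rd d) := parabolicCylinder t x r ∩ Ioo 0 T ×ˢ univ with hV
  have hΦc : ∀ φ ∈ testFunctions V, Continuous (spatialPartial i (spatialPartial j φ)) :=
    fun φ hφ => (contDiff_spatialPartial i (contDiff_spatialPartial j hφ.1)).continuous
  have hΦs : ∀ φ ∈ testFunctions V, HasCompactSupport (spatialPartial i (spatialPartial j φ)) :=
    fun φ hφ => hasCompactSupport_spatialPartial i (contDiff_spatialPartial j hφ.1)
      (hasCompactSupport_spatialPartial j hφ.1 hφ.2.1)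
  have hΦΩ : ∀ φ ∈ testFunctions V, Function.support (spatialPartial i (spatialPartial j φ)) ⊆
      Ioo 0 T ×ˢ univ :=
    fun φ hφ => (support_spatialPartial_subset_of_tsupport i j hφ).trans inter_subset_right
  have hint : ∀ φ ∈ testFunctions V, Integrable fun z =>
      backwardPotential h z * spatialPartial i (spatialPartial j φ) z := fun φ hφ =>
    integrable_backwardPotential_mul hM hT hp hm hg h0 (hΦc φ hφ) (hΦs φ hφ) (hΦΩ φ hφ)
  -- The distributional derivative as a functional on test functions. By adjointness and the duality
  -- estimate it is bounded by `C r^{p/2}` in `L²`, with `C` independent of the cylinder.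
  let L : testFunctions V →ₗ[ℝ] ℝ :=
    { toFun := fun φ => ∫ z, backwardPotential h z *
        spatialPartial i (spatialPartial j (φ : ℝ × Rd d → ℝ)) z
      map_add' := fun φ ψ => by
        rw [← integral_add (hint φ φ.2) (hint ψ ψ.2)]
        simp only [Submodule.coe_add]
        rw [spatialPartial_add j φ.2.1 ψ.2.1, spatialPartial_add i
          (contDiff_spatialPartial j φ.2.1) (contDiff_spatialPartial j ψ.2.1)]
        simp only [Pi.add_apply, mul_add]
      map_smul' := fun c φ => by
        simp only [Submodule.coe_smul, RingHom.id_apply, smul_eq_mul]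
        rw [spatialPartial_smul j c φ.2.1, spatialPartial_smul i c (contDiff_spatialPartial j φ.2.1),
          ← integral_const_mul]
        simp only [Pi.smul_apply, smul_eq_mul, mul_left_comm] }
  obtain ⟨v, hvm, hvb, hvL⟩ := exists_L2_representation (μ := volume) L (K := C * r ^ (p / 2))
    (by positivity) fun φ => by
      have h1 : L φ = ∫ w, h w * heatPotential (spatialPartial i (spatialPartial j φ)) w :=
        integral_backwardPotential_mul hM hT hp hm hg h0 (hΦc φ φ.2) (hΦs φ φ.2) (hΦΩ φ φ.2)
      rw [h1, ← Real.enorm_eq_ofReal_abs]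
      refine (enorm_integral_le_lintegral_enorm _).trans ?_
      simp only [enorm_mul]
      exact hest i j t ht x r hr φ φ.2.1 φ.2.2.1 (φ.2.2.2.trans inter_subset_left)
  refine ⟨v, hvm, hvb.trans (le_of_eq ?_), fun φ hφ => hvL ⟨φ, hφ⟩⟩
  congr 1
  rw [mul_pow, ← Real.rpow_natCast (r ^ _) 2, ← Real.rpow_mul hr.le]
  congr 2
  push_cast
  ring

/-- The weak second derivatives of a backward heat potential, with their parabolic Morrey bound. -/
theorem exists_weakDerivative_backwardPotential (hM : 0 ≤ M)
    (hT : 0 < T) (hp : p < d + 2) (hm : Measurable h)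
    (hg : GrowthBound p M fun z => ‖h z‖ₑ ^ 2) (h0 : ∀ w, w.1 ∉ Ioo 0 T → h w = 0) (i j : Fin d) :
    ∃ v : ℝ × Rd d → ℝ, Measurable v ∧ (∀ z, z.1 ∉ Ioo 0 T → v z = 0) ∧
      (∃ C : ℝ, 0 ≤ C ∧ GrowthBound p C fun z => ‖v z‖ₑ ^ 2) ∧
        ∀ φ ∈ testFunctions (Ioo 0 T ×ˢ (univ : Set (Rd d))),
          ∫ z, backwardPotential h z * spatialPartial i (spatialPartial j φ) z =
            ∫ z, v z * φ z := by
  obtain ⟨C, hC, hloc⟩ := exists_local_weakDerivative hM hT hp hm hg h0 i j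
  set Ω : Set (ℝ × Rd d) := Ioo 0 T ×ˢ univ with hΩ
  have hΩo : IsOpen Ω := isOpen_Ioo.prod isOpen_univ
  have hrn : ∀ n : ℕ, (0 : ℝ) < n + 1 + T := fun n => by positivity
  -- An exhaustion by cylinders based at the origin. Adding `1 + T` to the radius makes each of them
  -- span the whole time interval and contain the closed ball of radius `n` in space.
  choose w hwm hwb hwrep using fun n : ℕ => hloc 0 le_rfl (0 : Rd d) (n + 1 + T) (hrn n)
  set V : ℕ → Set (ℝ × Rd d) := fun n => parabolicCylinder 0 0 (n + 1 + T) ∩ Ω with hV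
  have hVo : ∀ n, IsOpen (V n) := fun n => (isOpen_parabolicCylinder _ _ _).inter hΩo
  have hmemV : ∀ (n : ℕ) (z : ℝ × Rd d), z ∈ Ω → ‖z.2‖ ≤ n → z ∈ V n := by
    intro n z hz hn
    refine ⟨⟨⟨hz.1.1, ?_⟩, ?_⟩, hz⟩
    · have h1 := hz.1.2
      have h2 : (0 : ℝ) ≤ n := by positivity
      nlinarith
    · rw [mem_ball_zero_iff]
      linarith
  have hL2 : ∀ {v : ℝ × Rd d → ℝ} {a : ℝ}, Measurable v →
      ∫⁻ z, ‖v z‖ₑ ^ 2 ≤ ENNReal.ofReal a → MemLp v 2 := by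
    intro v a hv hva
    refine ⟨hv.aestronglyMeasurable, ?_⟩
    rw [eLpNorm_lt_top_iff_lintegral_rpow_enorm_lt_top (by norm_num) (by norm_num)]
    simpa using hva.trans_lt ENNReal.ofReal_lt_top
  -- Countably many local representatives are glued by choosing at each point an index whose
  -- cylinder contains it; the choice is measurable.
  set v : ℝ × Rd d → ℝ := Ω.indicator fun z => w ⌈‖z.2‖⌉₊ z with hv
  have hvm : Measurable v := by
    refine Measurable.indicator ?_ hΩo.measurableSet
    have h1 : Measurable fun q : ℕ × (ℝ × Rd d) => w q.1 q.2 :=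
      measurable_from_prod_countable_right hwm
    exact h1.comp ((Nat.measurable_ceil.comp measurable_snd.norm).prodMk measurable_id)
  -- Any `L²` representative on an open `U` agrees with every `w n` on the overlap, up to a null
  -- set. A countable union of null sets remains null, so it agrees with `v` on `U`.
  have huniq : ∀ (U : Set (ℝ × Rd d)) (g : ℝ × Rd d → ℝ), IsOpen U → U ⊆ Ω → MemLp g 2 →
      (∀ φ ∈ testFunctions U, ∫ z, backwardPotential h z * spatialPartial i (spatialPartial j φ) z =
        ∫ z, g z * φ z) → ∀ᵐ z, z ∈ U → v z = g z := by
    intro U g hU hUΩ hg2 hrep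
    have h1 : ∀ n, ∀ᵐ z, z ∈ U ∩ V n → w n z = g z := fun n =>
      ae_eq_of_forall_testFunctions (hU.inter (hVo n)) (hL2 (hwm n) (hwb n)) hg2 fun φ hφ => by
        rw [← hwrep n φ ⟨hφ.1, hφ.2.1, hφ.2.2.trans inter_subset_right⟩,
          hrep φ ⟨hφ.1, hφ.2.1, hφ.2.2.trans inter_subset_left⟩]
    filter_upwards [ae_all_iff.2 h1] with z hz hzU
    rw [hv, indicator_of_mem (hUΩ hzU)]
    exact hz _ ⟨hzU, hmemV _ z (hUΩ hzU) (Nat.le_ceil _)⟩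
  have hv0 : ∀ z : ℝ × Rd d, z.1 ∉ Ioo 0 T → v z = 0 := fun z hz =>
    indicator_of_notMem (fun hz' => hz hz'.1) _
  refine ⟨v, hvm, hv0, ⟨C, hC, fun t ht x r hr => ?_⟩, fun φ hφ => ?_⟩
  -- The exhaustion gives no uniform bound on small cylinders. The growth of `v` comes from the
  -- representative built on the given cylinder, with which it coincides there.
  · obtain ⟨g, hgm, hgb, hgrep⟩ := hloc t ht x r hr
    have h1 := huniq _ g ((isOpen_parabolicCylinder t x r).inter hΩo) inter_subset_right
      (hL2 hgm hgb) hgrep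
    refine le_trans ?_ hgb
    rw [← lintegral_indicator (measurableSet_parabolicCylinder t x r)]
    refine lintegral_mono_ae ?_
    filter_upwards [h1] with z hz
    by_cases hzc : z ∈ parabolicCylinder t x r
    · rw [indicator_of_mem hzc]
      by_cases hzΩ : z ∈ Ω
      · rw [hz ⟨hzc, hzΩ⟩]
      · rw [hv, indicator_of_notMem hzΩ]
        simp
    · rw [indicator_of_notMem hzc]
      exact zero_le
  · obtain ⟨R, hR⟩ := hφ.2.1.isBounded.subset_closedBall (0 : ℝ × Rd d)
    have hφn : tsupport φ ⊆ V ⌈R⌉₊ := fun z hz => by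
      refine hmemV _ z (hφ.2.2 hz) ?_
      have h1 := hR hz
      rw [mem_closedBall_zero_iff] at h1
      exact ((norm_snd_le z).trans h1).trans (Nat.le_ceil R)
    rw [hwrep _ φ ⟨hφ.1, hφ.2.1, hφn⟩]
    refine integral_congr_ae ?_
    filter_upwards [huniq (V ⌈R⌉₊) (w ⌈R⌉₊) (hVo _) inter_subset_right (hL2 (hwm _) (hwb _))
      (hwrep _)] with z hz
    by_cases hzφ : φ z = 0
    · simp [hzφ]
    · rw [hz (hφn (subset_tsupport _ hzφ))]

end Potential

/-! ### From Hypothesis `H_p` to the source of the mild formulation -/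

theorem measurable_extendByZero {d : ℕ} {T : ℝ} {g : ℝ → Rd d → ℝ}
    (hg : Measurable fun z : ℝ × Rd d => g z.1 z.2) :
    Measurable fun z : ℝ × Rd d => extendByZero T g z.1 z.2 := by
  unfold extendByZero
  exact Measurable.ite (measurable_fst measurableSet_Icc) hg measurable_const

theorem HypothesisH.exists_forall_lintegral_le {d : ℕ} {p : ℝ} {g : ℝ → Rd d → ℝ}
    (hg : Measurable fun z : ℝ × Rd d => g z.1 z.2) (h : HypothesisH d p g) :
    ∃ M : ℝ, 0 < M ∧ ∀ t : ℝ, 0 ≤ t → ∀ (x : Rd d) (r : ℝ), 0 < r → r < 1 →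
      ∫⁻ z in parabolicCylinder t x r, ‖g z.1 z.2‖ₑ ≤ ENNReal.ofReal (M * r ^ p) := by
  obtain ⟨-, M, hM, hb⟩ := h
  refine ⟨M, hM, fun t ht x r hr hr1 => ?_⟩
  rw [lintegral_parabolicCylinder hg.enorm]
  exact (le_iSup₂ (f := fun (t : Ici (0 : ℝ)) (x : Rd d) =>
    ∫⁻ s in Ioo 0 (r ^ 2), ∫⁻ y in Metric.ball x r, ‖g (t + s) y‖ₑ) ⟨t, ht⟩ x).trans (hb r hr hr1)

theorem GrowthBound.hypothesisH {d : ℕ} {p M : ℝ} {g : ℝ → Rd d → ℝ} (hp : (d : ℝ) < p)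
    (hM : 0 ≤ M) (hg : Measurable fun z : ℝ × Rd d => g z.1 z.2)
    (h : GrowthBound p M fun z : ℝ × Rd d => ‖g z.1 z.2‖ₑ) : HypothesisH d p g := by
  refine ⟨hp, M + 1, by positivity, fun r hr _ => iSup₂_le fun t x => ?_⟩
  have h1 := h t t.2 x r hr
  rw [lintegral_parabolicCylinder hg.enorm] at h1
  refine h1.trans (ENNReal.ofReal_le_ofReal ?_)
  gcongr
  linarith

/-- The source term `⟨b, ∇u⟩ - f` of the mild formulation, extended by zero in time. -/
noncomputable def mildSource {d : ℕ} (T : ℝ) (b f u : ℝ → Rd d → Rd d) (z : ℝ × Rd d) : Rd d :=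
  (Ioo 0 T ×ˢ (univ : Set (Rd d))).indicator
    (fun z => fderiv ℝ (u z.1) z.2 (b z.1 z.2) - f z.1 z.2) z

section Mild

variable {d : ℕ} {T : ℝ} {b f u : ℝ → Rd d → Rd d}

theorem mildSource_of_mem {z : ℝ × Rd d} (hz : z.1 ∈ Ioo 0 T) :
    mildSource T b f u z = fderiv ℝ (u z.1) z.2 (b z.1 z.2) - f z.1 z.2 :=
  indicator_of_mem (show z ∈ Ioo 0 T ×ˢ univ from ⟨hz, mem_univ _⟩) _

theorem mildSource_of_notMem {z : ℝ × Rd d} (hz : z.1 ∉ Ioo 0 T) : mildSource T b f u z = 0 :=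
  indicator_of_notMem (fun h : z ∈ Ioo 0 T ×ˢ univ => hz h.1) _

theorem measurable_mildSource (hb : Measurable fun z : ℝ × Rd d => b z.1 z.2)
    (hf : Measurable fun z : ℝ × Rd d => f z.1 z.2) (hu : IsCb01 T u) :
    Measurable (mildSource T b f u) := by
  have hS : MeasurableSet (Ioo 0 T ×ˢ (univ : Set (Rd d))) := measurableSet_Ioo.prod .univ
  have hD : Measurable ((Ioo 0 T ×ˢ (univ : Set (Rd d))).indicator
      fun z => fderiv ℝ (u z.1) z.2) := by
    have := ((hu.continuousOn_fderiv.mono (prod_mono Ioo_subset_Icc_self le_rfl)).measurable_piecewise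
      (g := (0 : ℝ × Rd d → Rd d →L[ℝ] Rd d)) continuousOn_const hS)
    rwa [piecewise_eq_indicator] at this
  have h1 : Measurable fun z : ℝ × Rd d => (Ioo 0 T ×ˢ (univ : Set (Rd d))).indicator
      (fun z => fderiv ℝ (u z.1) z.2) z (b z.1 z.2) :=
    (isBoundedBilinearMap_apply (𝕜 := ℝ) (E := Rd d) (F := Rd d)).continuous.measurable.comp
      (hD.prodMk hb)
  have h2 : mildSource T b f u = (Ioo 0 T ×ˢ (univ : Set (Rd d))).indicator fun z =>
      (Ioo 0 T ×ˢ (univ : Set (Rd d))).indicator (fun z => fderiv ℝ (u z.1) z.2) z (b z.1 z.2) -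
        f z.1 z.2 := by
    ext1 z
    unfold mildSource
    by_cases hz : z ∈ Ioo 0 T ×ˢ (univ : Set (Rd d)) <;> simp only [indicator, hz, if_true, if_false]
  rw [h2]
  exact (h1.sub hf).indicator hS

/-- Boundedness of `∇u` together with `(a + b)² ≤ 2a² + 2b²`. -/
theorem exists_enorm_mildSource_sq_le (hu : IsCb01 T u) : ∃ C : ℝ, 0 ≤ C ∧ ∀ z : ℝ × Rd d,
    ‖mildSource T b f u z‖ₑ ^ 2 ≤
      ENNReal.ofReal C * ‖extendByZero T (fun t x => ‖b t x‖ ^ 2) z.1 z.2‖ₑ +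
        ENNReal.ofReal 2 * ‖extendByZero T (fun t x => ‖f t x‖ ^ 2) z.1 z.2‖ₑ := by
  obtain ⟨C, hC⟩ := hu.bounded_fderiv
  refine ⟨2 * C ^ 2, by positivity, fun z => ?_⟩
  by_cases hz : z.1 ∈ Ioo 0 T
  swap
  · simp [mildSource_of_notMem hz]
  have hz' := Ioo_subset_Icc_self hz
  rw [mildSource_of_mem hz]
  simp only [extendByZero, hz', if_true]
  rw [← ofReal_norm, ← ofReal_norm, ← ofReal_norm, Real.norm_of_nonneg (sq_nonneg _),
    Real.norm_of_nonneg (sq_nonneg _), ← ENNReal.ofReal_pow (norm_nonneg _),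
    ← ENNReal.ofReal_mul (by positivity), ← ENNReal.ofReal_mul (by norm_num),
    ← ENNReal.ofReal_add (by positivity) (by positivity)]
  refine ENNReal.ofReal_le_ofReal ?_
  have h1 : ‖fderiv ℝ (u z.1) z.2 (b z.1 z.2)‖ ≤ C * ‖b z.1 z.2‖ :=
    (ContinuousLinearMap.le_opNorm _ _).trans (by gcongr; exact hC z.1 hz' z.2)
  have h2 := (norm_sub_le (fderiv ℝ (u z.1) z.2 (b z.1 z.2)) (f z.1 z.2)).trans
    (add_le_add_left h1 _)
  calc _ ≤ (C * ‖b z.1 z.2‖ + ‖f z.1 z.2‖) ^ 2 := by gcongr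
    _ ≤ _ := by nlinarith [sq_nonneg (C * ‖b z.1 z.2‖ - ‖f z.1 z.2‖)]

/-- For radii below `1` the exponent may be lowered from `p` to `q`. Since the source vanishes
outside `(0,T)`, the bound then extends to all radii. -/
theorem exists_growthBound_mildSource {p q : ℝ} (hd : (d : ℝ) < q) (hq : q ≤ p)
    (hb_meas : Measurable fun z : ℝ × Rd d => b z.1 z.2)
    (hf_meas : Measurable fun z : ℝ × Rd d => f z.1 z.2)
    (hb : HypothesisH d p (extendByZero T fun t x => ‖b t x‖ ^ 2))
    (hf : HypothesisH d p (extendByZero T fun t x => ‖f t x‖ ^ 2)) (hu : IsCb01 T u) :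
    ∃ M : ℝ, 0 < M ∧ GrowthBound q M fun z => ‖mildSource T b f u z‖ₑ ^ 2 := by
  have hbm := measurable_extendByZero (T := T) (g := fun t x => ‖b t x‖ ^ 2) (hb_meas.norm.pow_const 2)
  have hfm := measurable_extendByZero (T := T) (g := fun t x => ‖f t x‖ ^ 2) (hf_meas.norm.pow_const 2)
  obtain ⟨Mb, hMb, hb'⟩ := hb.exists_forall_lintegral_le hbm
  obtain ⟨Mf, hMf, hf'⟩ := hf.exists_forall_lintegral_le hfm
  obtain ⟨C, hC, hle⟩ := exists_enorm_mildSource_sq_le (b := b) (f := f) hu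
  refine exists_growthBound (T := T) (M := C * Mb + 2 * Mf) (by positivity) hd.le
    ((measurable_mildSource hb_meas hf_meas hu).enorm.pow_const 2)
    (fun z hz => by simp [mildSource_of_notMem hz]) fun t ht x r hr hr1 => ?_
  calc _ ≤ ∫⁻ z in parabolicCylinder t x r,
        (ENNReal.ofReal C * ‖extendByZero T (fun t x => ‖b t x‖ ^ 2) z.1 z.2‖ₑ +
        ENNReal.ofReal 2 * ‖extendByZero T (fun t x => ‖f t x‖ ^ 2) z.1 z.2‖ₑ) := lintegral_mono fun z => hle z
    _ = ENNReal.ofReal C * (∫⁻ z in parabolicCylinder t x r,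
          ‖extendByZero T (fun t x => ‖b t x‖ ^ 2) z.1 z.2‖ₑ) +
        ENNReal.ofReal 2 * ∫⁻ z in parabolicCylinder t x r,
          ‖extendByZero T (fun t x => ‖f t x‖ ^ 2) z.1 z.2‖ₑ := by
        rw [lintegral_add_left (hbm.enorm.const_mul _), lintegral_const_mul _ hbm.enorm,
          lintegral_const_mul _ hfm.enorm]
    _ ≤ ENNReal.ofReal C * ENNReal.ofReal (Mb * r ^ p) +
        ENNReal.ofReal 2 * ENNReal.ofReal (Mf * r ^ p) := by
        gcongr
        · exact hb' t ht x r hr hr1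
        · exact hf' t ht x r hr hr1
    _ ≤ _ := by
        rw [← ENNReal.ofReal_mul hC, ← ENNReal.ofReal_mul (by norm_num),
          ← ENNReal.ofReal_add (by positivity) (by positivity)]
        refine ENNReal.ofReal_le_ofReal ?_
        have : r ^ p ≤ r ^ q := Real.rpow_le_rpow_of_exponent_ge hr hr1.le hq
        calc _ = (C * Mb + 2 * Mf) * r ^ p := by ring
          _ ≤ _ := by gcongr

/-- Components of a mild solution are backward heat potentials of the components of the source. -/
theorem IsMildSolution.apply_eq_backwardPotential (hu : IsMildSolution T b f u) (k : Fin d)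
    {z : ℝ × Rd d} (hz : z.1 ∈ Ioo 0 T) :
    u z.1 z.2 k = backwardPotential (fun w => mildSource T b f u w k) z := by
  have hz' := Ioo_subset_Icc_self hz
  have hint := hu.integrableOn z.1 hz' z.2
  have hS : MeasurableSet (Ioo z.1 T ×ˢ (univ : Set (Rd d))) := measurableSet_Ioo.prod .univ
  have h1 : u z.1 z.2 = ∫ w in Ioo z.1 T ×ˢ univ,
      heatKernel d (w.1 - z.1) z.2 w.2 • (fderiv ℝ (u w.1) w.2 (b w.1 w.2) - f w.1 w.2) := by
    rw [hu.eq_integral z.1 hz' z.2]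
    rw [Measure.volume_eq_prod] at hint ⊢
    rw [setIntegral_prod _ hint]
    simp
  have h2 := (EuclideanSpace.proj (𝕜 := ℝ) k : Rd d →L[ℝ] ℝ).integral_comp_comm hint
  simp only [PiLp.proj_apply] at h2
  rw [h1, ← h2, backwardPotential, ← integral_indicator hS]
  congr 1
  ext w
  by_cases hw : w ∈ Ioo z.1 T ×ˢ (univ : Set (Rd d))
  · rw [indicator_of_mem hw, mildSource_of_mem ⟨hz.1.trans hw.1.1, hw.1.2⟩]
    simp [spaceTimeKernel, hw.1.1]
  · rw [indicator_of_notMem hw]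
    -- Off the domain of the mild integral one factor vanishes: the source at times from `T` on, the
    -- kernel at times up to `z.1`.
    by_cases hw1 : z.1 < w.1
    · have : w.1 ∉ Ioo 0 T := fun h => hw ⟨⟨hw1, h.2⟩, mem_univ _⟩
      simp [mildSource_of_notMem this]
    · simp [spaceTimeKernel, hw1]

end Mild

/-! ### Assembling the Hessian -/

/-- The sup norm is at most the Euclidean one. Applied three times, this reduces the growth of the
maximal entry of the Hessian to that of each entry. -/
theorem enorm_pi_sq_le_sum {ι : Type*} [Fintype ι] {E : ι → Type*}
    [∀ i, SeminormedAddCommGroup (E i)] (v : ∀ i, E i) : ‖v‖ₑ ^ 2 ≤ ∑ i, ‖v i‖ₑ ^ 2 := by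
  simp only [← ofReal_norm, ← ENNReal.ofReal_pow (norm_nonneg _)]
  rw [← ENNReal.ofReal_sum_of_nonneg fun i _ => by positivity]
  refine ENNReal.ofReal_le_ofReal ?_
  have hS : 0 ≤ ∑ i, ‖v i‖ ^ 2 := Finset.sum_nonneg fun i _ => by positivity
  have h1 : ‖v‖ ≤ √(∑ i, ‖v i‖ ^ 2) := (pi_norm_le_iff_of_nonneg (Real.sqrt_nonneg _)).2 fun i =>
    Real.le_sqrt_of_sq_le (Finset.single_le_sum (f := fun i => ‖v i‖ ^ 2)
      (fun i _ => by positivity) (Finset.mem_univ i))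
  calc ‖v‖ ^ 2 ≤ √(∑ i, ‖v i‖ ^ 2) ^ 2 := by gcongr
    _ = _ := Real.sq_sqrt hS

/-- Every point of the strip lies in a large cylinder based at the origin, on which square
integrability implies integrability. -/
theorem GrowthBound.locallyIntegrableOn {d : ℕ} {p M T : ℝ} {E : Type*} [NormedAddCommGroup E]
    [MeasurableSpace E] [BorelSpace E] [SecondCountableTopology E] (hM : 0 ≤ M) (hT : 0 < T)
    {v : ℝ × Rd d → E} (hv : Measurable v) (h : GrowthBound p M fun z => ‖v z‖ₑ ^ 2) :
    LocallyIntegrableOn v (Ioo 0 T ×ˢ univ) := by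
  intro z hz
  refine ⟨parabolicCylinder 0 0 (‖z.2‖ + 1 + T), mem_nhdsWithin_of_mem_nhds
    ((isOpen_parabolicCylinder _ _ _).mem_nhds ⟨⟨hz.1.1, ?_⟩, ?_⟩),
    hv.aestronglyMeasurable, ?_⟩
  · have h1 := hz.1.2
    have h2 := norm_nonneg z.2
    nlinarith
  · rw [mem_ball_zero_iff]
    linarith
  · exact (GrowthBound.lintegral_le hM hv.enorm h le_rfl 0 (by positivity)).trans_lt
      ENNReal.ofReal_lt_top

theorem proposition4p6 (d : ℕ) (hd : 2 ≤ d) (T : ℝ) (hT : 0 < T) (p : ℝ)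
    (b f u : ℝ → Rd d → Rd d)
    (hb_meas : Measurable (fun z : ℝ × Rd d => b z.1 z.2))
    (hf_meas : Measurable (fun z : ℝ × Rd d => f z.1 z.2))
    (hb : HypothesisH d p (extendByZero T fun t x => ‖b t x‖ ^ 2))
    (hf : HypothesisH d p (extendByZero T fun t x => ‖f t x‖ ^ 2))
    (hu : IsMildSolution T b f u) :
    ∃ w : ℝ → Rd d → Fin d → Fin d → Fin d → ℝ, IsWeakHessian T u w ∧
      ∃ q : ℝ, (d : ℝ) < q ∧ q < p ∧
        HypothesisH d q (extendByZero T fun t x => ‖w t x‖ ^ 2) := by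
  -- Requiring `q < d + 2` makes the dyadic far-field sum converge even when `p ≥ d + 2`; `q < p` is
  -- demanded by the conclusion.
  obtain ⟨q, hdq, hq⟩ := exists_between (lt_min hb.1 (by linarith : (d : ℝ) < d + 2))
  obtain ⟨hqp, hqd⟩ := lt_min_iff.1 hq
  obtain ⟨M, hM, hg⟩ := exists_growthBound_mildSource hdq hqp.le hb_meas hf_meas hb hf hu.isCb01
  have hsm := measurable_mildSource hb_meas hf_meas hu.isCb01
  have hcomp : ∀ k : Fin d, Measurable fun z => mildSource T b f u z k := fun k =>
    (EuclideanSpace.proj (𝕜 := ℝ) k : Rd d →L[ℝ] ℝ).continuous.measurable.comp hsm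
  have hcg : ∀ k : Fin d, GrowthBound q M fun z => ‖mildSource T b f u z k‖ₑ ^ 2 := by
    intro k t ht x r hr
    refine le_trans (lintegral_mono fun z => ?_) (hg t ht x r hr)
    gcongr
    rw [← ofReal_norm, ← ofReal_norm]
    exact ENNReal.ofReal_le_ofReal (abs_apply_le_norm _ _)
  choose v hvm hv0 hvg hvrep using fun k i j : Fin d =>
    exists_weakDerivative_backwardPotential hM.le hT hqd (hcomp k) (hcg k)
      (fun w hw => by simp [mildSource_of_notMem hw]) i j
  choose C hC hvC using hvg
  set w : ℝ → Rd d → Fin d → Fin d → Fin d → ℝ := fun t x k i j => v k i j (t, x) with hw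
  have hwm : Measurable fun z : ℝ × Rd d => w z.1 z.2 :=
    measurable_pi_iff.2 fun k => measurable_pi_iff.2 fun i => measurable_pi_iff.2 fun j => hvm k i j
  have hCs : 0 ≤ ∑ k, ∑ i, ∑ j, C k i j :=
    Finset.sum_nonneg fun k _ => Finset.sum_nonneg fun i _ => Finset.sum_nonneg fun j _ => hC k i j
  have hwg : GrowthBound q (∑ k, ∑ i, ∑ j, C k i j) fun z : ℝ × Rd d => ‖w z.1 z.2‖ₑ ^ 2 := by
    intro t ht x r hr
    calc _ ≤ ∫⁻ z in parabolicCylinder t x r, ∑ k, ∑ i, ∑ j, ‖v k i j z‖ₑ ^ 2 := by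
          refine lintegral_mono fun z => (enorm_pi_sq_le_sum _).trans ?_
          gcongr with k
          refine (enorm_pi_sq_le_sum _).trans ?_
          gcongr with i
          exact enorm_pi_sq_le_sum _
      _ = ∑ k, ∑ i, ∑ j, ∫⁻ z in parabolicCylinder t x r, ‖v k i j z‖ₑ ^ 2 := by
          have hm : ∀ k i j, Measurable fun z => ‖v k i j z‖ₑ ^ 2 :=
            fun k i j => (hvm k i j).enorm.pow_const 2
          rw [lintegral_finsetSum _ fun k _ => Finset.measurable_sum _ fun i _ =>
            Finset.measurable_sum _ fun j _ => hm k i j]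
          refine Finset.sum_congr rfl fun k _ => ?_
          rw [lintegral_finsetSum _ fun i _ => Finset.measurable_sum _ fun j _ => hm k i j]
          refine Finset.sum_congr rfl fun i _ => ?_
          rw [lintegral_finsetSum _ fun j _ => hm k i j]
      _ ≤ ∑ k, ∑ i, ∑ j, ENNReal.ofReal (C k i j * r ^ q) := by
          gcongr with k _ i _ j _
          exact hvC k i j t ht x r hr
      _ = _ := by
          have hnn : ∀ k i j, 0 ≤ C k i j * r ^ q := fun k i j =>
            mul_nonneg (hC k i j) (by positivity)
          simp only [Finset.sum_mul]
          rw [ENNReal.ofReal_sum_of_nonneg fun k _ => Finset.sum_nonneg fun i _ =>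
            Finset.sum_nonneg fun j _ => hnn k i j]
          refine Finset.sum_congr rfl fun k _ => ?_
          rw [ENNReal.ofReal_sum_of_nonneg fun i _ => Finset.sum_nonneg fun j _ => hnn k i j]
          refine Finset.sum_congr rfl fun i _ => ?_
          rw [ENNReal.ofReal_sum_of_nonneg fun j _ => hnn k i j]
  refine ⟨w, ⟨hwm, GrowthBound.locallyIntegrableOn hCs hT hwm hwg, ?_⟩, q, hdq, hqp, ?_⟩
  · intro φ hφ hφs hφt k i j
    have hφV : φ ∈ testFunctions (Ioo 0 T ×ˢ (univ : Set (Rd d))) := ⟨hφ, hφs, hφt⟩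
    have hS : MeasurableSet (Ioo 0 T ×ˢ (univ : Set (Rd d))) := measurableSet_Ioo.prod .univ
    have h1 := hvrep k i j φ hφV
    -- The representation holds over all of space-time. Both integrands vanish off the strip, one
    -- through `v` and the other through the support of `φ`.
    have h2 := setIntegral_eq_integral_of_forall_compl_eq_zero (μ := volume)
      (s := Ioo 0 T ×ˢ (univ : Set (Rd d))) (f := fun z => v k i j z * φ z) fun z hz => by
        rw [hv0 k i j z fun h => hz ⟨h, mem_univ _⟩, zero_mul]
    have h3 := setIntegral_eq_integral_of_forall_compl_eq_zero (μ := volume)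
      (s := Ioo 0 T ×ˢ (univ : Set (Rd d)))
      (f := fun z => backwardPotential (fun w => mildSource T b f u w k) z *
        spatialPartial i (spatialPartial j φ) z) fun z hz => by
        rw [Function.notMem_support.1 fun h =>
          hz (support_spatialPartial_subset_of_tsupport i j hφV h), mul_zero]
    refine Eq.trans ?_ ((h3.trans h1).trans h2.symm)
    refine setIntegral_congr_fun hS fun z hz => ?_
    simp only [hu.apply_eq_backwardPotential k hz.1]
  · refine GrowthBound.hypothesisH hdq hCs
      (measurable_extendByZero (g := fun t x => ‖w t x‖ ^ 2) (hwm.norm.pow_const 2))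
      fun t ht x r hr => ?_
    refine le_trans (lintegral_mono fun z => ?_) (hwg t ht x r hr)
    simp only [extendByZero]
    split_ifs
    · simp
    · simp
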